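/- Let $(M,g)$ be a smooth Riemannian manifold (without boundary) of dimension $n$, and let $f$ be a smooth real-valued function on $M$ such that $(M,g)$ is a steady gradient Ricci soliton, $\mathrm{Ric} = D^2 f$. Put $X = \nabla f$. For a vector field $V$ let $\Delta V = g^{jk} D_j D_k V$ denote its rough Laplacian, and for a symmetric $(0,2)$-tensor $h$ let $$\Delta_L h_{ik} = \Delta h_{ik} + 2\, R_{ijkl}\, h^{jl} - \mathrm{Ric}_i^l\, h_{kl} - \mathrm{Ric}_k^l\, h_{il}$$ denote the Lichnerowicz Laplacian, where $\Delta h = g^{lk}D_lD_k h$, the sign of the Riemann tensor is such that $\mathrm{Ric}_{ik} = g^{jl} R_{ijkl}$, and $\mathscr{L}$ denotes the Lie derivative. Then: 1. If $W$ is a smooth vector field on $M$ satisfying $\Delta W + D_X W = 0$, then the Lie derivative $h = \mathscr{L}_W(g)$ satisfies $$\Delta_L h + \mathscr{L}_X(h) = 0.$$ 2. The vector field $X$ satisfies $\Delta X + D_X X = 0$. 3. The Ricci tensor satisfies $\Delta_L(\mathrm{Ric}) + \mathscr{L}_X(\mathrm{Ric}) = 0$. -/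

import Mathlib

open scoped Manifold ContDiff

noncomputable section

namespace RicciSoliton

/-! ### Tensor calculus in a coordinate system

Below, `G y i j` are the components `g_ij` of a Riemannian metric in a coordinate system, as functions
of the coordinates `y`, vector fields are given by their components `V y i` (standing for `V^i`), and
`(0,2)`-tensors by their components `h y i j` (standing for `h_ij`). All indices are written in the
order in which they appear in the usual notation. -/

/-- The coordinate space of an `n`-dimensional manifold. -/
abbrev Coord (n : ℕ) : Type := EuclideanSpace ℝ (Fin n)

section Coordinates

variable {n : ℕ}

/-- The partial derivative `∂_k u`. -/
def pd (k : Fin n) (u : Coord n → ℝ) (y : Coord n) : ℝ :=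
  fderiv ℝ u y (EuclideanSpace.single k (1 : ℝ))

/-- Components `g^{ij}` of the inverse metric. -/
def invMetric (G : Coord n → Matrix (Fin n) (Fin n) ℝ) (y : Coord n) (i j : Fin n) : ℝ :=
  (G y)⁻¹ i j

/-- Christoffel symbols of the Levi-Civita connection,
`Γ^k_ij = (1/2) g^{kl} (∂_i g_jl + ∂_j g_il - ∂_l g_ij)`, written `christoffel G y k i j`. -/
def christoffel (G : Coord n → Matrix (Fin n) (Fin n) ℝ) (y : Coord n) (k i j : Fin n) : ℝ :=
  (1 / 2 : ℝ) * ∑ l, invMetric G y k l *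
    (pd i (fun z => G z j l) y + pd j (fun z => G z i l) y - pd l (fun z => G z i j) y)

/-- The components `(R(∂_i, ∂_j) ∂_l)^m` of the curvature operator
`R(U, V) Z = D_U D_V Z - D_V D_U Z - D_[U,V] Z`. -/
def curvatureOp (G : Coord n → Matrix (Fin n) (Fin n) ℝ) (y : Coord n) (i j l m : Fin n) : ℝ :=
  pd i (fun z => christoffel G z m j l) y - pd j (fun z => christoffel G z m i l) y
    + ∑ p, (christoffel G y m i p * christoffel G y p j l
        - christoffel G y m j p * christoffel G y p i l)

/-- The Riemann tensor `R_ijkl = g(R(∂_i, ∂_j) ∂_l, ∂_k)`; with this sign convention the unit sphere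
has `R_ijkl = g_ik g_jl - g_il g_jk`, and `Ric_ik = g^{jl} R_ijkl`. -/
def riemann (G : Coord n → Matrix (Fin n) (Fin n) ℝ) (y : Coord n) (i j k l : Fin n) : ℝ :=
  ∑ m, G y k m * curvatureOp G y i j l m

/-- The Ricci tensor `Ric_ik = g^{jl} R_ijkl`. -/
def ricci (G : Coord n → Matrix (Fin n) (Fin n) ℝ) (y : Coord n) : Matrix (Fin n) (Fin n) ℝ :=
  fun i k => ∑ j, ∑ l, invMetric G y j l * riemann G y i j k l

/-- The Hessian `(D²u)_ij = ∂_i ∂_j u - Γ^k_ij ∂_k u`. -/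
def hessian (G : Coord n → Matrix (Fin n) (Fin n) ℝ) (u : Coord n → ℝ) (y : Coord n) :
    Matrix (Fin n) (Fin n) ℝ :=
  fun i j => pd i (pd j u) y - ∑ k, christoffel G y k i j * pd k u y

/-- The covariant derivative `D_j V^i = ∂_j V^i + Γ^i_jk V^k` of a vector field, written
`covVec G V y j i`. -/
def covVec (G : Coord n → Matrix (Fin n) (Fin n) ℝ) (V : Coord n → Fin n → ℝ) (y : Coord n)
    (j i : Fin n) : ℝ :=
  pd j (fun z => V z i) y + ∑ k, christoffel G y i j k * V y k

/-- The second covariant derivative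
`D_j D_k V^i = ∂_j (D_k V^i) + Γ^i_jm D_k V^m - Γ^m_jk D_m V^i`, written `covVec₂ G V y j k i`. -/
def covVec₂ (G : Coord n → Matrix (Fin n) (Fin n) ℝ) (V : Coord n → Fin n → ℝ) (y : Coord n)
    (j k i : Fin n) : ℝ :=
  pd j (fun z => covVec G V z k i) y
    + ∑ m, (christoffel G y i j m * covVec G V y k m - christoffel G y m j k * covVec G V y m i)

/-- The rough Laplacian of a vector field, `(ΔV)^i = g^{jk} D_j D_k V^i`. -/
def lapVec (G : Coord n → Matrix (Fin n) (Fin n) ℝ) (V : Coord n → Fin n → ℝ) (y : Coord n)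
    (i : Fin n) : ℝ :=
  ∑ j, ∑ k, invMetric G y j k * covVec₂ G V y j k i

/-- The covariant derivative `(D_X V)^i = X^j D_j V^i` of `V` in the direction of `X`. -/
def dirCovVec (G : Coord n → Matrix (Fin n) (Fin n) ℝ) (X V : Coord n → Fin n → ℝ) (y : Coord n)
    (i : Fin n) : ℝ :=
  ∑ j, X y j * covVec G V y j i

/-- The covariant derivative `D_k h_ij = ∂_k h_ij - Γ^m_ki h_mj - Γ^m_kj h_im` of a
`(0,2)`-tensor, written `covTen G h y k i j`. -/
def covTen (G h : Coord n → Matrix (Fin n) (Fin n) ℝ) (y : Coord n) (k i j : Fin n) : ℝ :=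
  pd k (fun z => h z i j) y
    - ∑ m, (christoffel G y m k i * h y m j + christoffel G y m k j * h y i m)

/-- The second covariant derivative `D_l D_k h_ij` of a `(0,2)`-tensor, written
`covTen₂ G h y l k i j`. -/
def covTen₂ (G h : Coord n → Matrix (Fin n) (Fin n) ℝ) (y : Coord n) (l k i j : Fin n) : ℝ :=
  pd l (fun z => covTen G h z k i j) y
    - ∑ m, (christoffel G y m l k * covTen G h y m i j
        + christoffel G y m l i * covTen G h y k m j
        + christoffel G y m l j * covTen G h y k i m)

/-- The rough Laplacian of a `(0,2)`-tensor, `Δh_ij = g^{lk} D_l D_k h_ij`. -/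
def lapTen (G h : Coord n → Matrix (Fin n) (Fin n) ℝ) (y : Coord n) (i j : Fin n) : ℝ :=
  ∑ l, ∑ k, invMetric G y l k * covTen₂ G h y l k i j

/-- `h^{jl} = g^{ja} g^{lb} h_ab`. -/
def raiseBoth (G h : Coord n → Matrix (Fin n) (Fin n) ℝ) (y : Coord n) (j l : Fin n) : ℝ :=
  ∑ a, ∑ b, invMetric G y j a * invMetric G y l b * h y a b

/-- `Ric_i^l = g^{lm} Ric_im`. -/
def ricciMixed (G : Coord n → Matrix (Fin n) (Fin n) ℝ) (y : Coord n) (i l : Fin n) : ℝ :=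
  ∑ m, invMetric G y l m * ricci G y i m

/-- The Lichnerowicz Laplacian
`Δ_L h_ik = Δh_ik + 2 R_ijkl h^{jl} - Ric_i^l h_kl - Ric_k^l h_il`. -/
def lichnerowicz (G h : Coord n → Matrix (Fin n) (Fin n) ℝ) (y : Coord n) (i k : Fin n) : ℝ :=
  lapTen G h y i k + 2 * (∑ j, ∑ l, riemann G y i j k l * raiseBoth G h y j l)
    - (∑ l, ricciMixed G y i l * h y k l) - (∑ l, ricciMixed G y k l * h y i l)

/-- The Lie derivative of a `(0,2)`-tensor,
`(L_V h)_ij = V^k ∂_k h_ij + (∂_i V^k) h_kj + (∂_j V^k) h_ik`. -/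
def lieDeriv (V : Coord n → Fin n → ℝ) (h : Coord n → Matrix (Fin n) (Fin n) ℝ) (y : Coord n) :
    Matrix (Fin n) (Fin n) ℝ :=
  fun i j => ∑ k, (V y k * pd k (fun z => h z i j) y
    + pd i (fun z => V z k) y * h y k j + pd j (fun z => V z k) y * h y i k)

end Coordinates

/-! ### Riemannian manifolds -/

section Manifold

variable {n : ℕ} {M : Type*} [TopologicalSpace M] [ChartedSpace (Coord n) M]
  [IsManifold (𝓡 n) ∞ M]

/-- Smooth Riemannian metrics on the smooth `n`-manifold `M`. -/
abbrev Metric (n : ℕ) (M : Type*) [TopologicalSpace M] [ChartedSpace (Coord n) M]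
    [IsManifold (𝓡 n) ∞ M] :=
  Bundle.ContMDiffRiemannianMetric (𝓡 n) ∞ (Coord n) (fun p : M => TangentSpace (𝓡 n) p)

/-- Vector fields on `M` (not necessarily smooth). -/
abbrev VField (n : ℕ) (M : Type*) [TopologicalSpace M] [ChartedSpace (Coord n) M] :=
  (p : M) → TangentSpace (𝓡 n) p

/-- Smoothness of a vector field, as a section of the tangent bundle. -/
def VField.IsSmooth (W : VField n M) : Prop :=
  ContMDiff (𝓡 n) ((𝓡 n).prod 𝓘(ℝ, Coord n)) ∞
    (fun p : M => (Bundle.TotalSpace.mk' (Coord n) p (W p) : TangentBundle (𝓡 n) M))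

/-- The components `g_ij = g(∂_i, ∂_j)` of `g` in the chart `e`. -/
def metricIn (g : Metric n M) (e : OpenPartialHomeomorph M (Coord n)) (y : Coord n) :
    Matrix (Fin n) (Fin n) ℝ :=
  fun i j => g.inner (e.symm y)
    (mfderiv (𝓡 n) (𝓡 n) e.symm y (EuclideanSpace.single i (1 : ℝ) : Coord n))
    (mfderiv (𝓡 n) (𝓡 n) e.symm y (EuclideanSpace.single j (1 : ℝ) : Coord n))

/-- The components `W^i = dx^i(W)` of the vector field `W` in the chart `e`. -/
def fieldIn (W : VField n M) (e : OpenPartialHomeomorph M (Coord n)) (y : Coord n) (i : Fin n) : ℝ :=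
  let w : Coord n := mfderiv (𝓡 n) (𝓡 n) e (e.symm y) (W (e.symm y))
  w i

/-- The coordinate expression of the function `f` in the chart `e`. -/
def funIn (f : M → ℝ) (e : OpenPartialHomeomorph M (Coord n)) (y : Coord n) : ℝ :=
  f (e.symm y)

/-- The metric at `p`, as a bilinear form. -/
def formAt (g : Metric n M) (p : M) : LinearMap.BilinForm ℝ (Coord n) :=
  LinearMap.mk₂ ℝ (fun v w : Coord n => g.inner p v w)
    (fun v v' w => by
      have h := (g.inner p).map_add v v'
      exact congrArg (fun L => L w) h)
    (fun c v w => by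
      have h := (g.inner p).map_smul c v
      exact congrArg (fun L => L w) h)
    (fun v w w' => (g.inner p v).map_add w w')
    (fun c v w => (g.inner p v).map_smul c w)

theorem formAt_nondegenerate (g : Metric n M) (p : M) : (formAt g p).Nondegenerate := by
  have key : ∀ v : Coord n, formAt g p v v = 0 → v = 0 := by
    intro v hv
    by_contra hne
    exact (g.pos p v hne).ne' hv
  exact ⟨fun v hv => key v (hv v), fun v hv => key v (hv v)⟩

/-- The gradient of `f`: the vector field with `g(∇f, v) = df(v)` for all tangent vectors `v`. -/
def gradient (g : Metric n M) (f : M → ℝ) : VField n M := fun p =>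
  ((formAt g p).toDual (formAt_nondegenerate g p)).symm
    (mfderiv (𝓡 n) 𝓘(ℝ, ℝ) f p : Coord n →L[ℝ] ℝ).toLinearMap

theorem inner_gradient (g : Metric n M) (f : M → ℝ) (p : M) (v : TangentSpace (𝓡 n) p) :
    g.inner p (gradient g f p) v = mfderiv (𝓡 n) 𝓘(ℝ, ℝ) f p v :=
  LinearMap.BilinForm.apply_toDual_symm_apply (hB := formAt_nondegenerate g p) _ _

/-! Equations between tensor fields on `M` are expressed by saying that they hold in components, in
every chart of the maximal smooth atlas and at every point of the chart. -/

/-- The steady gradient soliton equation `Ric = D²f`. -/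
def IsSteadyGradientSoliton (g : Metric n M) (f : M → ℝ) : Prop :=
  ∀ e ∈ IsManifold.maximalAtlas (𝓡 n) ∞ M, ∀ y ∈ e.target, ∀ i j : Fin n,
    ricci (metricIn g e) y i j = hessian (metricIn g e) (funIn f e) y i j

/-- The equation `ΔW + D_X W = 0` for a vector field `W`. -/
def SolvesVectorEq (g : Metric n M) (X W : VField n M) : Prop :=
  ∀ e ∈ IsManifold.maximalAtlas (𝓡 n) ∞ M, ∀ y ∈ e.target, ∀ i : Fin n,
    lapVec (metricIn g e) (fieldIn W e) y i
      + dirCovVec (metricIn g e) (fieldIn X e) (fieldIn W e) y i = 0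

/-- The equation `Δ_L h + L_X h = 0` for a `(0,2)`-tensor field `h`, which is given by its components
`h e` in every chart `e`. -/
def SolvesLichnerowiczEq (g : Metric n M) (X : VField n M)
    (h : OpenPartialHomeomorph M (Coord n) → Coord n → Matrix (Fin n) (Fin n) ℝ) : Prop :=
  ∀ e ∈ IsManifold.maximalAtlas (𝓡 n) ∞ M, ∀ y ∈ e.target, ∀ i k : Fin n,
    lichnerowicz (metricIn g e) (h e) y i k + lieDeriv (fieldIn X e) (h e) y i k = 0

/-- The tensor field `L_W g`, by its components in every chart. -/
def lieMetric (g : Metric n M) (W : VField n M) :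
    OpenPartialHomeomorph M (Coord n) → Coord n → Matrix (Fin n) (Fin n) ℝ :=
  fun e => lieDeriv (fieldIn W e) (metricIn g e)

/-- The Ricci tensor field of `g`, by its components in every chart. -/
def ricciField (g : Metric n M) :
    OpenPartialHomeomorph M (Coord n) → Coord n → Matrix (Fin n) (Fin n) ℝ :=
  fun e => ricci (metricIn g e)

end Manifold

end RicciSoliton

end

noncomputable section

namespace RicciSoliton

/-! Let B = Dw for a 1-form w. Commuting derivatives in ΔB brings out D(Δw), one Ricci term, twice
the curvature term of the Lichnerowicz Laplacian, and the divergence of the curvature contracted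
with w (`lap2_D1`). The soliton equation says Ric = Dξ, where ξ is dual to X, and it enters twice.
It gives DX = Ric (`DV_soliton`). It also turns the contracted Bianchi identity D^a R_aipk = D_p
Ric_ik - D_k Ric_ip into a commutator of derivatives of ξ, so that D^a R_aipk = -X^j R_jipk
(`div_Rm`, `D2_Ric_sub`, `div_DF_soliton`).

If Δw = -D_X w, differentiating the right side gives -Ric_i^j B_jk and -X^j D_i D_j w_k. The first
cancels the Ricci term; commuting D_i and D_j in the second leaves a curvature term that the
divergence cancels. What remains is ΔB_ik + D_X B_ik + 2 R_ijkl B^jl = 0. Symmetrizing B gives the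
same equation for h = B + Bᵀ. Since DX = Ric, L_X h exceeds D_X h by exactly the two Ricci terms
that Δ_L subtracts, so Δ_L h + L_X h = 0 (`Lich_add_Lie_soliton`).

For X itself, Δξ = div Ric, and tracing the divergence formula once more gives div Ric = -Ric(X) =
-D_X ξ (`lap1_soliton`); scalar curvature never appears. The Ricci equation is then the case w =
ξ/2, whose symmetrized derivative is Ric.

All of this is algebra in a commutative ring with commuting derivations and a symmetric invertible
matrix. In each chart it is applied to the ring of smooth functions on the chart's target. Of
positive definiteness, that algebra needs only the invertibility of the metric matrix. -/

/-- The algebraic data behind tensor calculus in a coordinate system: commuting derivations `d k` of a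
commutative ring of functions, and a symmetric invertible matrix `g` of functions. -/
structure MetricCalculus (n : ℕ) (A : Type*) [CommRing A] [Algebra ℝ A] where
  d : Fin n → Derivation ℝ A A
  d_comm : ∀ i j a, d i (d j a) = d j (d i a)
  g : Matrix (Fin n) (Fin n) A
  gi : Matrix (Fin n) (Fin n) A
  g_symm : ∀ i j, g i j = g j i
  gi_symm : ∀ i j, gi i j = gi j i
  g_mul_gi : g * gi = 1

namespace MetricCalculus

variable {n : ℕ} {A : Type*} [CommRing A] [Algebra ℝ A] (S : MetricCalculus n A)

/-! #### The Levi-Civita connection -/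

/-- Christoffel symbols. -/
def Γ (k i j : Fin n) : A :=
  (1 / 2 : ℝ) • ∑ l, S.gi k l * (S.d i (S.g j l) + S.d j (S.g i l) - S.d l (S.g i j))

/-- Covariant derivative of a `1`-form. -/
def D1 (w : Fin n → A) : Matrix (Fin n) (Fin n) A := fun k i =>
  S.d k (w i) - ∑ m, S.Γ m k i * w m

/-- Covariant derivative of a `(0,2)`-tensor. -/
def D2 (h : Matrix (Fin n) (Fin n) A) (k i j : Fin n) : A :=
  S.d k (h i j) - ∑ m, (S.Γ m k i * h m j + S.Γ m k j * h i m)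

/-- Covariant derivative of a `(0,3)`-tensor. -/
def D3 (t : Fin n → Fin n → Fin n → A) (l k i j : Fin n) : A :=
  S.d l (t k i j)
    - ∑ m, (S.Γ m l k * t m i j + S.Γ m l i * t k m j + S.Γ m l j * t k i m)

/-- Covariant derivative of a `(0,4)`-tensor. -/
def D4 (t : Fin n → Fin n → Fin n → Fin n → A) (a b i p k : Fin n) : A :=
  S.d a (t b i p k)
    - ∑ m, (S.Γ m a b * t m i p k + S.Γ m a i * t b m p k + S.Γ m a p * t b i m k
        + S.Γ m a k * t b i p m)

/-- The matrix of Christoffel symbols in a coordinate direction. -/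
def Γm (a : Fin n) : Matrix (Fin n) (Fin n) A := fun m l => S.Γ m a l

/-- Entrywise derivative of a matrix. -/
def dM (a : Fin n) (N : Matrix (Fin n) (Fin n) A) : Matrix (Fin n) (Fin n) A :=
  fun i j => S.d a (N i j)

/-- The curvature operator `R(∂_a, ∂_b)` as a matrix. -/
def F (a b : Fin n) : Matrix (Fin n) (Fin n) A :=
  S.dM a (S.Γm b) - S.dM b (S.Γm a) + (S.Γm a * S.Γm b - S.Γm b * S.Γm a)

/-- The covariant derivative of the curvature operator. -/
def DF (a b c : Fin n) : Matrix (Fin n) (Fin n) A :=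
  S.dM a (S.F b c) + (S.Γm a * S.F b c - S.F b c * S.Γm a)
    - ∑ m, (S.Γ m a b • S.F m c + S.Γ m a c • S.F b m)

/-- The Riemann tensor `R_ijkl = g_km R(∂_i, ∂_j)^m_l`. -/
def Rm (i j k l : Fin n) : A := ∑ m, S.g k m * S.F i j m l

/-- The Ricci tensor `g^{jl} R_ijkl`. -/
def Ric : Matrix (Fin n) (Fin n) A := fun i k => ∑ j, ∑ l, S.gi j l * S.Rm i j k l

theorem Γ_symm (k i j : Fin n) : S.Γ k i j = S.Γ k j i := by
  simp only [Γ]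
  congr 1
  refine Finset.sum_congr rfl fun l _ => ?_
  rw [S.g_symm i j]
  ring

theorem gi_mul_g : S.gi * S.g = 1 := mul_eq_one_comm.mp S.g_mul_gi

theorem sum_g_gi (i k : Fin n) : ∑ j, S.g i j * S.gi j k = if i = k then 1 else 0 := by
  have := congrFun (congrFun S.g_mul_gi i) k
  rwa [Matrix.mul_apply, Matrix.one_apply] at this

theorem sum_gi_g (i k : Fin n) : ∑ j, S.gi i j * S.g j k = if i = k then 1 else 0 := by
  have := congrFun (congrFun S.gi_mul_g i) k
  rwa [Matrix.mul_apply, Matrix.one_apply] at this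

/-- Lowering after raising. -/
theorem lower_raise (v : Fin n → A) (i : Fin n) : ∑ j, S.g i j * ∑ k, S.gi j k * v k = v i := by
  simp only [Finset.mul_sum, ← mul_assoc]
  rw [Finset.sum_comm]
  simp only [← Finset.sum_mul, sum_g_gi, ite_mul, one_mul, zero_mul, Finset.sum_ite_eq,
    Finset.mem_univ, if_true]

/-- Raising after lowering. -/
theorem raise_lower (v : Fin n → A) (i : Fin n) : ∑ j, S.gi i j * ∑ k, S.g j k * v k = v i := by
  simp only [Finset.mul_sum, ← mul_assoc]
  rw [Finset.sum_comm]
  simp only [← Finset.sum_mul, sum_gi_g, ite_mul, one_mul, zero_mul, Finset.sum_ite_eq,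
    Finset.mem_univ, if_true]

theorem lower_Γ (p i j : Fin n) : ∑ k, S.g p k * S.Γ k i j =
    (1 / 2 : ℝ) • (S.d i (S.g j p) + S.d j (S.g i p) - S.d p (S.g i j)) := by
  simp only [Γ, mul_smul_comm]
  rw [← Finset.smul_sum, S.lower_raise fun l => S.d i (S.g j l) + S.d j (S.g i l) - S.d l (S.g i j)]

/-- The Levi-Civita connection is metric. -/
theorem d_g (k i j : Fin n) :
    S.d k (S.g i j) = ∑ m, (S.Γ m k i * S.g m j + S.Γ m k j * S.g i m) := by
  have h1 := S.lower_Γ j k i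
  have h2 := S.lower_Γ i k j
  have e1 : ∑ m, S.Γ m k i * S.g m j = ∑ m, S.g j m * S.Γ m k i :=
    Finset.sum_congr rfl fun m _ => by rw [S.g_symm m j, mul_comm]
  have e2 : ∑ m, S.Γ m k j * S.g i m = ∑ m, S.g i m * S.Γ m k j :=
    Finset.sum_congr rfl fun m _ => mul_comm _ _
  rw [Finset.sum_add_distrib, e1, e2, h1, h2, S.g_symm j i, S.g_symm k i, S.g_symm k j]
  module

theorem D2_g (k i j : Fin n) : S.D2 S.g k i j = 0 := by
  rw [D2, d_g, sub_self]

/-! #### Matrix calculus -/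

theorem dM_apply (a i j : Fin n) (N : Matrix (Fin n) (Fin n) A) : S.dM a N i j = S.d a (N i j) := rfl

theorem dM_add (a : Fin n) (N P : Matrix (Fin n) (Fin n) A) :
    S.dM a (N + P) = S.dM a N + S.dM a P := by
  ext i j; simp [dM]

theorem dM_sub (a : Fin n) (N P : Matrix (Fin n) (Fin n) A) :
    S.dM a (N - P) = S.dM a N - S.dM a P := by
  ext i j; simp [dM]

theorem dM_neg (a : Fin n) (N : Matrix (Fin n) (Fin n) A) : S.dM a (-N) = -S.dM a N := by
  ext i j; simp [dM]

theorem dM_mul (a : Fin n) (N P : Matrix (Fin n) (Fin n) A) :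
    S.dM a (N * P) = S.dM a N * P + N * S.dM a P := by
  ext i j
  simp only [dM, Matrix.mul_apply, Matrix.add_apply, map_sum, Derivation.leibniz, smul_eq_mul,
    ← Finset.sum_add_distrib]
  exact Finset.sum_congr rfl fun m _ => by ring

theorem dM_transpose (a : Fin n) (N : Matrix (Fin n) (Fin n) A) :
    S.dM a N.transpose = (S.dM a N).transpose := rfl

theorem dM_one (a : Fin n) : S.dM a 1 = 0 := by
  ext i j
  rw [dM_apply, Matrix.one_apply]
  split_ifs <;> simp

theorem dM_comm (a b : Fin n) (N : Matrix (Fin n) (Fin n) A) :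
    S.dM a (S.dM b N) = S.dM b (S.dM a N) := by
  ext i j; exact S.d_comm a b _

theorem dM_g (a : Fin n) : S.dM a S.g = (S.Γm a).transpose * S.g + S.g * S.Γm a := by
  ext i j
  simp only [dM_apply, d_g, Matrix.add_apply, Matrix.mul_apply, Matrix.transpose_apply, Γm,
    Finset.sum_add_distrib]
  congr 1
  exact Finset.sum_congr rfl fun m _ => mul_comm _ _

/-- Differentiate `gi * g = 1`, insert `dM_g`, and multiply by `gi` on the right. -/
theorem dM_gi (a : Fin n) : S.dM a S.gi = -(S.Γm a * S.gi + S.gi * (S.Γm a).transpose) := by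
  have h := S.dM_mul a S.gi S.g
  rw [gi_mul_g, dM_one, dM_g] at h
  have h' : S.dM a S.gi = S.dM a S.gi * S.g * S.gi := by
    rw [mul_assoc, g_mul_gi, mul_one]
  have h2 : S.dM a S.gi * S.g = -(S.gi * ((S.Γm a).transpose * S.g + S.g * S.Γm a)) :=
    eq_neg_of_add_eq_zero_left h.symm
  rw [h', h2]
  have e1 : S.gi * ((S.Γm a).transpose * S.g + S.g * S.Γm a) * S.gi
      = S.gi * (S.Γm a).transpose * (S.g * S.gi) + S.gi * S.g * S.Γm a * S.gi := by noncomm_ring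
  rw [neg_mul, e1, g_mul_gi, gi_mul_g, mul_one, one_mul, add_comm]

theorem d_gi (c a b : Fin n) :
    S.d c (S.gi a b) = -∑ m, (S.Γ a c m * S.gi m b + S.Γ b c m * S.gi a m) := by
  have h := congrFun (congrFun (S.dM_gi c) a) b
  simp only [dM_apply, Matrix.neg_apply, Matrix.add_apply, Matrix.mul_apply,
    Matrix.transpose_apply, Γm] at h
  rw [h, Finset.sum_add_distrib]
  congr 2
  exact Finset.sum_congr rfl fun m _ => mul_comm _ _

/-! #### Symmetries of the curvature -/

theorem F_antisymm (a b : Fin n) : S.F a b = -S.F b a := by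
  simp only [F]; abel

theorem F_apply (a b m l : Fin n) : S.F a b m l = S.d a (S.Γ m b l) - S.d b (S.Γ m a l)
    + ∑ p, (S.Γ m a p * S.Γ p b l - S.Γ m b p * S.Γ p a l) := by
  simp only [F, Matrix.add_apply, Matrix.sub_apply, dM_apply, Matrix.mul_apply, Γm,
    Finset.sum_sub_distrib]

/-- First Bianchi identity: once the torsion-free symmetry of Γ is used, the cyclic sum cancels. -/
theorem F_bianchi (a b c m : Fin n) : S.F a b m c + S.F b c m a + S.F c a m b = 0 := by
  simp only [F_apply, Finset.sum_sub_distrib, S.Γ_symm _ b a, S.Γ_symm _ c a, S.Γ_symm _ c b]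
  ring

/-- The second Bianchi identity. -/
theorem DF_bianchi (a b c : Fin n) : S.DF a b c + S.DF b c a + S.DF c a b = 0 := by
  -- The part acting on the matrix indices is the Jacobi identity for the operators ∂_a + Γ_a.
  have key : (S.dM a (S.F b c) + (S.Γm a * S.F b c - S.F b c * S.Γm a))
      + (S.dM b (S.F c a) + (S.Γm b * S.F c a - S.F c a * S.Γm b))
      + (S.dM c (S.F a b) + (S.Γm c * S.F a b - S.F a b * S.Γm c)) = 0 := by
    simp only [F, dM_add, dM_sub, dM_mul, S.dM_comm b a, S.dM_comm c a, S.dM_comm c b]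
    noncomm_ring
  -- The connection terms on the two form indices cancel in pairs: F is antisymmetric and Γ
  -- symmetric in those indices.
  have corr : (∑ m, (S.Γ m a b • S.F m c + S.Γ m a c • S.F b m))
      + (∑ m, (S.Γ m b c • S.F m a + S.Γ m b a • S.F c m))
      + (∑ m, (S.Γ m c a • S.F m b + S.Γ m c b • S.F a m)) = 0 := by
    rw [← Finset.sum_add_distrib, ← Finset.sum_add_distrib]
    refine Finset.sum_eq_zero fun m _ => ?_
    rw [S.F_antisymm m c, S.F_antisymm m a, S.F_antisymm m b, S.Γ_symm m b a, S.Γ_symm m c a,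
      S.Γ_symm m c b]
    module
  simp only [DF]
  refine (?_ : _ = _ - _).trans ((congrArg₂ (· - ·) key corr).trans (sub_zero 0))
  abel

/-! #### Ricci identities -/

theorem D2_eq (h : Matrix (Fin n) (Fin n) A) (b i j : Fin n) :
    S.D2 h b i j = (S.dM b h - (S.Γm b).transpose * h - h * S.Γm b) i j := by
  simp only [D2, Matrix.sub_apply, dM_apply, Matrix.mul_apply, Matrix.transpose_apply, Γm,
    Finset.sum_add_distrib, mul_comm (h i _)]
  ring

/-- With b frozen, D_b h is an ordinary matrix and D_a acts on it as on a (0,2)-tensor. The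
connection term for b is split off; it is symmetric in a and b, so it drops out of the commutator.
-/
theorem D3_D2 (h : Matrix (Fin n) (Fin n) A) (a b i j : Fin n) :
    S.D3 (S.D2 h) a b i j =
      S.D2 (S.dM b h - (S.Γm b).transpose * h - h * S.Γm b) a i j
        - ∑ m, S.Γ m a b * S.D2 h m i j := by
  simp only [D3, S.D2_eq h b]
  rw [D2]
  simp only [Finset.sum_add_distrib]
  ring

/-- The Ricci identity for `(0,2)`-tensors. -/
theorem ricci_identity₂ (h : Matrix (Fin n) (Fin n) A) (a b i j : Fin n) :
    S.D3 (S.D2 h) a b i j = S.D3 (S.D2 h) b a i j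
      - ∑ m, S.F a b m i * h m j - ∑ m, S.F a b m j * h i m := by
  -- The commutator of the operators h ↦ ∂_b h - Γ_bᵀ h - h Γ_b is a pure matrix identity.
  have key : (S.dM a (S.dM b h - (S.Γm b).transpose * h - h * S.Γm b)
        - (S.Γm a).transpose * (S.dM b h - (S.Γm b).transpose * h - h * S.Γm b)
        - (S.dM b h - (S.Γm b).transpose * h - h * S.Γm b) * S.Γm a)
      = (S.dM b (S.dM a h - (S.Γm a).transpose * h - h * S.Γm a)
        - (S.Γm b).transpose * (S.dM a h - (S.Γm a).transpose * h - h * S.Γm a)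
        - (S.dM a h - (S.Γm a).transpose * h - h * S.Γm a) * S.Γm b)
      - (S.F a b).transpose * h - h * S.F a b := by
    simp only [F, dM_sub, dM_mul, S.dM_comm b a, dM_transpose, Matrix.transpose_add,
      Matrix.transpose_sub, Matrix.transpose_mul]
    noncomm_ring
  have key' := congrFun (congrFun key i) j
  rw [D3_D2, D3_D2, S.D2_eq _ a, S.D2_eq _ b, key']
  simp only [Matrix.sub_apply, Matrix.mul_apply, Matrix.transpose_apply, S.Γ_symm _ a b,
    mul_comm (h i _)]
  ring

/-- The Ricci identity for `1`-forms. -/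
theorem ricci_identity₁ (w : Fin n → A) (a b k : Fin n) :
    S.D2 (S.D1 w) a b k = S.D2 (S.D1 w) b a k - ∑ m, S.F a b m k * w m := by
  -- The 1-form is stored as a matrix with every row equal to w, so that its commutator also becomes
  -- a matrix identity; any row can be read off, here row k.
  obtain ⟨N, hN⟩ : ∃ N : Matrix (Fin n) (Fin n) A, ∀ r k, N r k = w k :=
    ⟨fun _ k => w k, fun _ _ => rfl⟩
  have h1 : ∀ b r k, S.D1 w b k = (S.dM b N - N * S.Γm b) r k := fun b r k => by
    simp only [D1, Matrix.sub_apply, dM_apply, Matrix.mul_apply, Γm, hN, mul_comm (w _)]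
  have h2 : ∀ a b, S.D2 (S.D1 w) a b k = (S.dM a (S.dM b N - N * S.Γm b)
      - (S.dM b N - N * S.Γm b) * S.Γm a) k k - ∑ m, S.Γ m a b * S.D1 w m k := fun a b => by
    rw [Matrix.sub_apply, dM_apply, Matrix.mul_apply, ← h1 b k k]
    simp only [← h1 b k, D2, Γm, Finset.sum_add_distrib, mul_comm (S.D1 w b _)]
    ring
  have key : (S.dM a (S.dM b N - N * S.Γm b) - (S.dM b N - N * S.Γm b) * S.Γm a)
      = (S.dM b (S.dM a N - N * S.Γm a) - (S.dM a N - N * S.Γm a) * S.Γm b) - N * S.F a b := by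
    simp only [F, dM_sub, dM_mul, S.dM_comm b a]
    noncomm_ring
  rw [h2, h2, key]
  simp only [Matrix.sub_apply, Matrix.mul_apply, S.Γ_symm _ a b, hN, mul_comm (w _)]
  ring

/-! #### Symmetries of the Riemann tensor -/

theorem Rm_antisymm_left (i j k l : Fin n) : S.Rm i j k l = -S.Rm j i k l := by
  simp only [Rm, S.F_antisymm i j, Matrix.neg_apply, mul_neg, Finset.sum_neg_distrib]

/-- The Ricci identity applied to the parallel tensor g: both second derivatives vanish and only the
two curvature terms remain. -/
theorem Rm_antisymm_right (i j k l : Fin n) : S.Rm i j k l = -S.Rm i j l k := by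
  have h0 : S.D2 S.g = fun _ _ _ => 0 := by
    funext k i j; exact S.D2_g k i j
  have h := S.ricci_identity₂ S.g i j l k
  simp only [h0, D3, map_zero, mul_zero, add_zero, Finset.sum_const_zero, sub_zero] at h
  have e1 : ∑ m, S.F i j m l * S.g m k = S.Rm i j k l :=
    Finset.sum_congr rfl fun m _ => by rw [S.g_symm m k, mul_comm]
  have e2 : ∑ m, S.F i j m k * S.g l m = S.Rm i j l k :=
    Finset.sum_congr rfl fun m _ => mul_comm _ _
  rw [e1, e2] at h
  linear_combination h

theorem Rm_bianchi (i j k l : Fin n) : S.Rm i j k l + S.Rm j l k i + S.Rm l i k j = 0 := by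
  simp only [Rm, ← Finset.sum_add_distrib, ← mul_add, F_bianchi, mul_zero, Finset.sum_const_zero]

/-- The scalar 1/2 comes from the real algebra structure; the ring itself need not be a domain. -/
theorem eq_of_two_mul_eq {x y : A} (h : 2 * x = 2 * y) : x = y := by
  have h' := congrArg (fun z => (1 / 2 : ℝ) • z) h
  simp only [two_mul, smul_add, ← add_smul] at h'
  norm_num at h'
  exact h'

/-- The octahedron argument: four instances of the first Bianchi identity combine, by the two
antisymmetries, into twice the claim. -/
theorem Rm_pair (i j k l : Fin n) : S.Rm i j k l = S.Rm k l i j := by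
  apply eq_of_two_mul_eq
  have b1 := S.Rm_bianchi i j k l
  have b2 := S.Rm_bianchi j k l i
  have b3 := S.Rm_bianchi k l i j
  have b4 := S.Rm_bianchi l i j k
  simp only [S.Rm_antisymm_left k i, S.Rm_antisymm_left l i, S.Rm_antisymm_left l j,
    S.Rm_antisymm_right _ _ j i, S.Rm_antisymm_right _ _ k i, S.Rm_antisymm_right _ _ l i,
    S.Rm_antisymm_right _ _ k j, S.Rm_antisymm_right _ _ l j, S.Rm_antisymm_right _ _ l k]
    at b1 b2 b3 b4
  linear_combination b1 - b2 - b3 + b4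

theorem Ric_symm (i k : Fin n) : S.Ric i k = S.Ric k i := by
  simp only [Ric]
  rw [Finset.sum_comm]
  refine Finset.sum_congr rfl fun j _ => Finset.sum_congr rfl fun l _ => ?_
  rw [S.gi_symm, S.Rm_pair]

/-- The Ricci tensor as a trace of the curvature operator. -/
theorem Ric_eq_trace (i k : Fin n) : S.Ric i k = ∑ a, S.F a k a i := by
  have h : ∀ j l, S.Rm i j k l = S.Rm l k j i := fun j l => by
    rw [S.Rm_pair, S.Rm_antisymm_left, S.Rm_antisymm_right, neg_neg]
  simp only [Ric, h]
  rw [Finset.sum_comm]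
  refine Finset.sum_congr rfl fun l _ => ?_
  simp only [S.gi_symm _ l]
  exact S.raise_lower (fun m => S.F l k m i) l

/-- The form in which a trace of the Ricci identity yields the Ricci tensor in `lap2_D1`. -/
theorem raise_Ric (i m : Fin n) :
    ∑ p, S.gi m p * S.Ric i p = -∑ a, ∑ b, S.gi a b * S.F a i m b := by
  simp only [Ric, Finset.mul_sum]
  rw [Finset.sum_comm, ← Finset.sum_neg_distrib]
  refine Finset.sum_congr rfl fun j _ => ?_
  rw [Finset.sum_comm, ← Finset.sum_neg_distrib]
  refine Finset.sum_congr rfl fun l _ => ?_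
  have h := S.raise_lower (fun q => S.F i j q l) m
  rw [S.F_antisymm j i, Matrix.neg_apply, ← h, mul_neg, neg_neg, Finset.mul_sum]
  exact Finset.sum_congr rfl fun p _ => by rw [Rm]; ring

theorem DF_antisymm (a b c : Fin n) : S.DF a b c = -S.DF a c b := by
  have h1 : S.dM a (S.F b c) = -S.dM a (S.F c b) := by
    rw [S.F_antisymm b c, dM_neg]
  rw [DF, DF, h1]
  simp only [Finset.sum_add_distrib, fun m => S.F_antisymm m c, fun m => S.F_antisymm b m,
    smul_neg, Finset.sum_neg_distrib, mul_neg, neg_mul]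
  abel

theorem DF_apply (a b c i j : Fin n) : S.DF a b c i j = S.d a (S.F b c i j)
    + (∑ m, S.Γ i a m * S.F b c m j - ∑ m, S.F b c i m * S.Γ m a j)
    - ∑ m, (S.Γ m a b * S.F m c i j + S.Γ m a c * S.F b m i j) := by
  simp only [DF, Matrix.sub_apply, Matrix.add_apply, dM_apply, Matrix.mul_apply, Γm,
    Matrix.sum_apply, Matrix.smul_apply, smul_eq_mul]

/-- Lowering an index commutes with covariant differentiation because g is parallel; in matrix form
this is `dM_g`. -/
theorem D4_Rm (a b i p k : Fin n) :
    S.D4 S.Rm a b i p k = ∑ m, S.g p m * S.DF a b i m k := by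
  have hR : ∀ b i p k, S.Rm b i p k = (S.g * S.F b i) p k := fun _ _ _ _ => rfl
  have h2 : S.D4 S.Rm a b i p k = S.D2 (S.g * S.F b i) a p k
      - ∑ m, (S.Γ m a b * S.Rm m i p k + S.Γ m a i * S.Rm b m p k) := by
    simp only [D4, D2, hR, Finset.sum_add_distrib]
    ring
  have key : S.dM a (S.g * S.F b i) - (S.Γm a).transpose * (S.g * S.F b i)
      - S.g * S.F b i * S.Γm a
      = S.g * (S.dM a (S.F b i) + (S.Γm a * S.F b i - S.F b i * S.Γm a)) := by
    rw [dM_mul, dM_g]; noncomm_ring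
  have h3 : ∑ m, (S.Γ m a b * S.Rm m i p k + S.Γ m a i * S.Rm b m p k)
      = (S.g * ∑ m, (S.Γ m a b • S.F m i + S.Γ m a i • S.F b m)) p k := by
    simp only [hR, Finset.mul_sum, mul_add, Matrix.mul_smul, Matrix.sum_apply, Matrix.add_apply,
      Matrix.smul_apply, smul_eq_mul]
  rw [h2, D2_eq, key, h3, ← Matrix.sub_apply, ← mul_sub]
  rfl

theorem D4_Rm_pair (a b i p k : Fin n) : S.D4 S.Rm a b i p k = S.D4 S.Rm a p k b i := by
  have h : S.Rm = fun b i p k => S.Rm p k b i := by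
    funext b i p k; exact S.Rm_pair b i p k
  conv_lhs => rw [h]
  simp only [D4, Finset.sum_add_distrib]
  ring

theorem D4_Rm_antisymm_left (a b i p k : Fin n) : S.D4 S.Rm a b i p k = -S.D4 S.Rm a i b p k := by
  simp only [D4_Rm, S.DF_antisymm a b i, Matrix.neg_apply, mul_neg, Finset.sum_neg_distrib]

theorem D2_symm {h : Matrix (Fin n) (Fin n) A} (hh : ∀ i j, h i j = h j i) (k i j : Fin n) :
    S.D2 h k i j = S.D2 h k j i := by
  simp only [D2, hh i j, hh _ j, hh i _, Finset.sum_add_distrib]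
  ring

/-- Covariant differentiation commutes with the trace: the connection terms of the contracted upper
and lower index cancel. -/
theorem trace_DF (c b i : Fin n) : ∑ a, S.DF c a b a i = S.D2 S.Ric c i b := by
  simp only [DF_apply, D2, Ric_eq_trace, Finset.sum_add_distrib, Finset.sum_sub_distrib, map_sum,
    Finset.mul_sum]
  have e1 : ∑ a, ∑ m, S.Γ m c a * S.F m b a i = ∑ a, ∑ m, S.Γ a c m * S.F a b m i :=
    Finset.sum_comm
  have e2 : ∑ a, ∑ m, S.F a b a m * S.Γ m c i = ∑ m, ∑ a, S.Γ m c i * S.F a b a m := by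
    rw [Finset.sum_comm]
    exact Finset.sum_congr rfl fun m _ => Finset.sum_congr rfl fun a _ => mul_comm _ _
  have e3 : ∑ a, ∑ m, S.Γ m c b * S.F a m a i = ∑ m, ∑ a, S.Γ m c b * S.F a m a i :=
    Finset.sum_comm
  rw [e1, e2, e3]
  ring

/-- The contracted second Bianchi identity for the full Riemann tensor. -/
theorem div_Rm (i p k : Fin n) : ∑ a, ∑ b, S.gi a b * S.D4 S.Rm a b i p k
    = S.D2 S.Ric p i k - S.D2 S.Ric k i p := by
  -- Pair symmetry moves the divergence index to the endomorphism slots, where contracting with the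
  -- inverse metric becomes a plain trace over the upper index.
  simp only [S.D4_Rm_pair _ _ i p k, S.D4_Rm _ p k]
  have h1 : ∀ a, ∑ b, S.gi a b * ∑ m, S.g b m * S.DF a p k m i = S.DF a p k a i := fun a =>
    S.raise_lower (fun m => S.DF a p k m i) a
  -- Second Bianchi identity, arranged so that both terms on the right are traces covered by
  -- `trace_DF`.
  have h2 : ∀ a, S.DF a p k a i = S.DF p a k a i - S.DF k a p a i := fun a => by
    have h := congrFun (congrFun (S.DF_bianchi a p k) a) i
    rw [S.DF_antisymm p k a] at h
    simp only [Matrix.add_apply, Matrix.neg_apply, Matrix.zero_apply] at h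
    linear_combination h
  simp only [h1, h2, Finset.sum_sub_distrib, trace_DF]

/-! #### Linearity and permutations of indices -/

theorem D2_add (h h' : Matrix (Fin n) (Fin n) A) (k i j : Fin n) :
    S.D2 (h + h') k i j = S.D2 h k i j + S.D2 h' k i j := by
  simp only [D2, Matrix.add_apply, map_add, mul_add, Finset.sum_add_distrib]
  ring

theorem D2_transpose (h : Matrix (Fin n) (Fin n) A) (k i j : Fin n) :
    S.D2 h.transpose k i j = S.D2 h k j i := by
  simp only [D2, Matrix.transpose_apply, Finset.sum_add_distrib]
  ring

theorem D3_D2_add (h h' : Matrix (Fin n) (Fin n) A) (l k i j : Fin n) :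
    S.D3 (S.D2 (h + h')) l k i j = S.D3 (S.D2 h) l k i j + S.D3 (S.D2 h') l k i j := by
  simp only [D3, D2_add, map_add, mul_add, Finset.sum_add_distrib]
  ring

theorem D3_D2_transpose (h : Matrix (Fin n) (Fin n) A) (l k i j : Fin n) :
    S.D3 (S.D2 h.transpose) l k i j = S.D3 (S.D2 h) l k j i := by
  simp only [D3, D2_transpose, Finset.sum_add_distrib]
  ring

theorem D3_sub (s t : Fin n → Fin n → Fin n → A) (l k i j : Fin n) :
    S.D3 (fun k i j => s k i j - t k i j) l k i j = S.D3 s l k i j - S.D3 t l k i j := by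
  simp only [D3, map_sub, mul_sub, Finset.sum_add_distrib, Finset.sum_sub_distrib]
  ring

theorem D3_swap (t : Fin n → Fin n → Fin n → A) (l k i j : Fin n) :
    S.D3 (fun k i j => t i k j) l k i j = S.D3 t l i k j := by
  simp only [D3, Finset.sum_add_distrib]
  ring

/-! #### Product rules -/

theorem D3_F_mul (w : Fin n → A) (a b i k : Fin n) :
    S.D3 (fun b i k => ∑ m, S.F b i m k * w m) a b i k
      = ∑ m, S.DF a b i m k * w m + ∑ m, S.F b i m k * S.D1 w a m := by
  simp only [D3, D1, DF_apply, map_sum, Derivation.leibniz, smul_eq_mul, Finset.sum_add_distrib,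
    Finset.mul_sum, mul_sub, sub_mul, add_mul, Finset.sum_sub_distrib, Finset.sum_mul]
  have e1 : ∑ m, ∑ l, S.F b i m k * (S.Γ l a m * w l)
      = ∑ m, ∑ l, S.Γ m a l * S.F b i l k * w m := by
    rw [Finset.sum_comm]
    exact Finset.sum_congr rfl fun m _ => Finset.sum_congr rfl fun l _ => by ring
  have e2 : ∑ m, ∑ l, S.Γ m a b * (S.F m i l k * w l)
      = ∑ m, ∑ l, S.Γ l a b * S.F l i m k * w m := by
    rw [Finset.sum_comm]
    exact Finset.sum_congr rfl fun m _ => Finset.sum_congr rfl fun l _ => by ring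
  have e3 : ∑ m, ∑ l, S.Γ m a i * (S.F b m l k * w l)
      = ∑ m, ∑ l, S.Γ l a i * S.F b l m k * w m := by
    rw [Finset.sum_comm]
    exact Finset.sum_congr rfl fun m _ => Finset.sum_congr rfl fun l _ => by ring
  have e4 : ∑ m, ∑ l, S.Γ m a k * (S.F b i l m * w l)
      = ∑ m, ∑ l, S.F b i m l * S.Γ l a k * w m := by
    rw [Finset.sum_comm]
    exact Finset.sum_congr rfl fun m _ => Finset.sum_congr rfl fun l _ => by ring
  have e5 : ∑ m, w m * S.d a (S.F b i m k) = ∑ m, S.d a (S.F b i m k) * w m :=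
    Finset.sum_congr rfl fun m _ => mul_comm _ _
  rw [e1, e2, e3, e4, e5]
  ring

/-- Covariant differentiation commutes with contraction by the metric. -/
theorem contract_D3 (t : Fin n → Fin n → Fin n → A) (c k : Fin n) :
    ∑ a, ∑ b, S.gi a b * S.D3 t c a b k
      = S.D1 (fun k => ∑ a, ∑ b, S.gi a b * t a b k) c k := by
  simp only [D3, D1, d_gi, map_sum, Derivation.leibniz, smul_eq_mul, Finset.sum_add_distrib,
    Finset.mul_sum, mul_sub, mul_add, mul_neg, Finset.sum_sub_distrib, Finset.sum_neg_distrib]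
  -- The derivative of g^{ab} contributes two connection terms, which `e1` and `e2` match with those
  -- of the first two slots of t; `e3` handles the free index.
  have e1 : ∑ a, ∑ b, ∑ m, t a b k * (S.Γ a c m * S.gi m b)
      = ∑ a, ∑ b, ∑ m, S.gi a b * (S.Γ m c a * t m b k) := by
    rw [Finset.sum_comm]
    conv_rhs => rw [Finset.sum_comm]
    refine Finset.sum_congr rfl fun b _ => ?_
    rw [Finset.sum_comm]
    exact Finset.sum_congr rfl fun m _ => Finset.sum_congr rfl fun a _ => by ring
  have e2 : ∑ a, ∑ b, ∑ m, t a b k * (S.Γ b c m * S.gi a m)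
      = ∑ a, ∑ b, ∑ m, S.gi a b * (S.Γ m c b * t a m k) := by
    refine Finset.sum_congr rfl fun a _ => ?_
    rw [Finset.sum_comm]
    exact Finset.sum_congr rfl fun m _ => Finset.sum_congr rfl fun b _ => by ring
  have e3 : ∑ m, ∑ a, ∑ b, S.Γ m c k * (S.gi a b * t a b m)
      = ∑ a, ∑ b, ∑ m, S.gi a b * (S.Γ m c k * t a b m) := by
    rw [Finset.sum_comm]
    refine Finset.sum_congr rfl fun a _ => ?_
    rw [Finset.sum_comm]
    exact Finset.sum_congr rfl fun b _ => Finset.sum_congr rfl fun m _ => by ring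
  rw [e1, e2, e3]
  ring

/-- Covariant derivative of a vector field. -/
def DV (V : Fin n → A) (j i : Fin n) : A := S.d j (V i) + ∑ k, S.Γ i j k * V k

theorem D1_dir (V : Fin n → A) (h : Matrix (Fin n) (Fin n) A) (i k : Fin n) :
    S.D1 (fun k => ∑ j, V j * h j k) i k
      = ∑ j, S.DV V i j * h j k + ∑ j, V j * S.D2 h i j k := by
  simp only [D1, D2, DV, map_sum, Derivation.leibniz, smul_eq_mul, Finset.sum_add_distrib,
    Finset.mul_sum, mul_sub, mul_add, add_mul, Finset.sum_sub_distrib, Finset.sum_mul]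
  have e1 : ∑ j, ∑ l, S.Γ j i l * V l * h j k = ∑ j, ∑ m, V j * (S.Γ m i j * h m k) := by
    rw [Finset.sum_comm]
    exact Finset.sum_congr rfl fun m _ => Finset.sum_congr rfl fun l _ => by ring
  have e2 : ∑ m, ∑ j, S.Γ m i k * (V j * h j m) = ∑ j, ∑ m, V j * (S.Γ m i k * h j m) := by
    rw [Finset.sum_comm]
    exact Finset.sum_congr rfl fun m _ => Finset.sum_congr rfl fun l _ => by ring
  have e3 : ∑ j, h j k * S.d i (V j) = ∑ j, S.d i (V j) * h j k :=
    Finset.sum_congr rfl fun m _ => mul_comm _ _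
  rw [e1, e2, e3]
  ring

/-- Lowering the index of a vector field. -/
def lower (V : Fin n → A) (i : Fin n) : A := ∑ j, S.g i j * V j

/-- The product rule `D1_dir` with h = g, whose derivative term vanishes because g is parallel. -/
theorem D1_lower (V : Fin n → A) (k i : Fin n) :
    S.D1 (S.lower V) k i = ∑ j, S.g i j * S.DV V k j := by
  have h : S.lower V = fun k => ∑ j, V j * S.g j k := by
    funext k; exact Finset.sum_congr rfl fun j _ => by rw [S.g_symm, mul_comm]
  rw [h, D1_dir]
  simp only [D2_g, mul_zero, Finset.sum_const_zero, add_zero]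
  exact Finset.sum_congr rfl fun j _ => by rw [S.g_symm, mul_comm]

/-- Second covariant derivative of a vector field. -/
def DVV (V : Fin n → A) (j k i : Fin n) : A :=
  S.d j (S.DV V k i) + ∑ m, (S.Γ i j m * S.DV V k m - S.Γ m j k * S.DV V m i)

theorem D2_D1_lower (V : Fin n → A) (a b i : Fin n) :
    S.D2 (S.D1 (S.lower V)) a b i = ∑ j, S.g i j * S.DVV V a b j := by
  -- For fixed b, the components D_b V^j are treated as a vector field so that `D1_lower` applies
  -- again; the connection term for b is carried separately.
  have h1 : S.D2 (S.D1 (S.lower V)) a b i = S.D1 (S.lower fun j => S.DV V b j) a i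
      - ∑ m, S.Γ m a b * S.D1 (S.lower V) m i := by
    simp only [D2, D1.eq_1 S (S.lower fun j => S.DV V b j), lower.eq_1 S fun j => S.DV V b j,
      D1_lower, Finset.sum_add_distrib]
    ring
  have h2 : ∀ j, S.DVV V a b j = S.DV (fun j => S.DV V b j) a j - ∑ m, S.Γ m a b * S.DV V m j :=
    fun j => by simp only [DVV, DV.eq_1 S (fun j => S.DV V b j), Finset.sum_sub_distrib]; ring
  rw [h1, D1_lower]
  simp only [D1_lower, h2, mul_sub, Finset.sum_sub_distrib, Finset.mul_sum]
  congr 1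
  rw [Finset.sum_comm]
  exact Finset.sum_congr rfl fun j _ => Finset.sum_congr rfl fun m _ => by ring

/-! #### Steady gradient solitons -/

/-- The rough Laplacian of a `1`-form. -/
def lap1 (w : Fin n → A) (k : Fin n) : A := ∑ a, ∑ b, S.gi a b * S.D2 (S.D1 w) a b k

/-- The rough Laplacian of a `(0,2)`-tensor. -/
def lap2 (h : Matrix (Fin n) (Fin n) A) (i k : Fin n) : A :=
  ∑ a, ∑ b, S.gi a b * S.D3 (S.D2 h) a b i k

/-- The Ricci tensor with its second index raised. -/
def RicMixed (i l : Fin n) : A := ∑ m, S.gi l m * S.Ric i m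

/-- A `(0,2)`-tensor with both indices raised. -/
def raise₂ (h : Matrix (Fin n) (Fin n) A) (j l : Fin n) : A :=
  ∑ a, ∑ b, S.gi j a * S.gi l b * h a b

/-- The Lichnerowicz Laplacian. -/
def Lich (h : Matrix (Fin n) (Fin n) A) (i k : Fin n) : A :=
  S.lap2 h i k + 2 * (∑ j, ∑ l, S.Rm i j k l * S.raise₂ h j l)
    - (∑ l, S.RicMixed i l * h k l) - (∑ l, S.RicMixed k l * h i l)

/-- The Lie derivative of a `(0,2)`-tensor. -/
def Lie (V : Fin n → A) (h : Matrix (Fin n) (Fin n) A) : Matrix (Fin n) (Fin n) A :=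
  fun i j => ∑ k, (V k * S.d k (h i j) + S.d i (V k) * h k j + S.d j (V k) * h i k)

theorem lap1_lower (V : Fin n → A) (i : Fin n) :
    S.lap1 (S.lower V) i = ∑ l, S.g i l * ∑ a, ∑ b, S.gi a b * S.DVV V a b l := by
  simp only [lap1, D2_D1_lower, Finset.mul_sum]
  conv_rhs => rw [Finset.sum_comm]
  refine Finset.sum_congr rfl fun a _ => ?_
  conv_rhs => rw [Finset.sum_comm]
  exact Finset.sum_congr rfl fun b _ => Finset.sum_congr rfl fun l _ => by ring

/-- The Lie derivative in terms of the Levi-Civita connection. -/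
theorem Lie_eq (V : Fin n → A) (h : Matrix (Fin n) (Fin n) A) (i j : Fin n) :
    S.Lie V h i j = ∑ k, V k * S.D2 h k i j + ∑ k, S.DV V i k * h k j
      + ∑ k, S.DV V j k * h i k := by
  simp only [Lie, D2, DV, mul_sub, add_mul, Finset.sum_add_distrib, Finset.sum_sub_distrib,
    Finset.mul_sum, mul_add, Finset.sum_mul]
  -- The connection terms of D_V h cancel those of DV because the connection is torsion-free.
  have e1 : ∑ k, ∑ m, V k * (S.Γ m k i * h m j) = ∑ k, ∑ m, S.Γ k i m * V m * h k j := by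
    rw [Finset.sum_comm]
    exact Finset.sum_congr rfl fun k _ => Finset.sum_congr rfl fun m _ => by
      rw [S.Γ_symm k m i]; ring
  have e2 : ∑ k, ∑ m, V k * (S.Γ m k j * h i m) = ∑ k, ∑ m, S.Γ k j m * V m * h i k := by
    rw [Finset.sum_comm]
    exact Finset.sum_congr rfl fun k _ => Finset.sum_congr rfl fun m _ => by
      rw [S.Γ_symm k m j]; ring
  rw [e1, e2]
  ring

/-- `L_V g` is the symmetrized covariant derivative of the `1`-form dual to `V`. -/
theorem Lie_g (V : Fin n → A) :
    S.Lie V S.g = S.D1 (S.lower V) + (S.D1 (S.lower V)).transpose := by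
  ext i j
  rw [Lie_eq, Matrix.add_apply, Matrix.transpose_apply]
  simp only [D2_g, mul_zero, Finset.sum_const_zero, zero_add, D1_lower]
  congr 1
  · exact Finset.sum_congr rfl fun k _ => by rw [S.g_symm, mul_comm]
  · exact Finset.sum_congr rfl fun k _ => mul_comm _ _

/-- The rough Laplacian of the covariant derivative of a `1`-form. -/
theorem lap2_D1 (w : Fin n → A) (i k : Fin n) :
    S.lap2 (S.D1 w) i k = S.D1 (S.lap1 w) i k + ∑ m, S.RicMixed i m * S.D1 w m k
      - 2 * ∑ a, ∑ b, S.gi a b * ∑ m, S.F a i m k * S.D1 w b m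
      - ∑ m, (∑ a, ∑ b, S.gi a b * S.DF a b i m k) * w m := by
  -- The index i is moved outwards in two steps: past b by the Ricci identity for 1-forms, then past
  -- a by the one for (0,2)-tensors.
  have h1 : S.D2 (S.D1 w) = fun b i k => S.D2 (S.D1 w) i b k - ∑ m, S.F b i m k * w m := by
    funext b i k; exact S.ricci_identity₁ w b i k
  have h2 : ∀ a b, S.D3 (S.D2 (S.D1 w)) a b i k = S.D3 (S.D2 (S.D1 w)) i a b k
      - ∑ m, S.F a i m b * S.D1 w m k - ∑ m, S.F a i m k * S.D1 w b m
      - ∑ m, S.DF a b i m k * w m - ∑ m, S.F b i m k * S.D1 w a m := fun a b => by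
    conv_lhs => rw [h1]
    rw [S.D3_sub (fun b i k => S.D2 (S.D1 w) i b k), S.D3_swap, S.D3_F_mul, S.ricci_identity₂]
    ring
  simp only [lap2, h2, mul_sub, Finset.sum_sub_distrib, S.contract_D3]
  have e1 : ∑ a, ∑ b, S.gi a b * ∑ m, S.F a i m b * S.D1 w m k
      = -∑ m, S.RicMixed i m * S.D1 w m k := by
    simp only [RicMixed, raise_Ric, Finset.mul_sum, Finset.sum_mul, neg_mul,
      Finset.sum_neg_distrib, neg_neg]
    conv_rhs => rw [Finset.sum_comm]
    refine Finset.sum_congr rfl fun a _ => ?_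
    conv_rhs => rw [Finset.sum_comm]
    exact Finset.sum_congr rfl fun b _ => Finset.sum_congr rfl fun m _ => by ring
  -- The two mixed curvature terms agree after tracing, as g^{ab} is symmetric; hence the factor 2.
  have e2 : ∑ a, ∑ b, S.gi a b * ∑ m, S.F b i m k * S.D1 w a m
      = ∑ a, ∑ b, S.gi a b * ∑ m, S.F a i m k * S.D1 w b m := by
    rw [Finset.sum_comm]
    exact Finset.sum_congr rfl fun a _ => Finset.sum_congr rfl fun b _ => by rw [S.gi_symm]
  have e3 : ∑ a, ∑ b, S.gi a b * ∑ m, S.DF a b i m k * w m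
      = ∑ m, (∑ a, ∑ b, S.gi a b * S.DF a b i m k) * w m := by
    simp only [Finset.mul_sum, Finset.sum_mul]
    conv_rhs => rw [Finset.sum_comm]
    refine Finset.sum_congr rfl fun a _ => ?_
    conv_rhs => rw [Finset.sum_comm]
    exact Finset.sum_congr rfl fun b _ => Finset.sum_congr rfl fun m _ => by ring
  have e4 : (fun k => ∑ a, ∑ b, S.gi a b * S.D2 (S.D1 w) a b k) = S.lap1 w := rfl
  rw [e1, e2, e3, e4]
  ring

/-- The curvature term of the Lichnerowicz Laplacian. -/
theorem curvature_term (h : Matrix (Fin n) (Fin n) A) (i k : Fin n) :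
    ∑ j, ∑ l, S.Rm i j k l * S.raise₂ h j l
      = ∑ a, ∑ b, S.gi a b * ∑ m, S.F a i m k * h b m := by
  have h1 : ∀ a m, S.F a i m k = ∑ l, S.gi m l * S.Rm i a k l := fun a m => by
    rw [← S.raise_lower (fun q => S.F a i q k) m]
    refine Finset.sum_congr rfl fun l _ => ?_
    rw [S.Rm_antisymm_left, S.Rm_antisymm_right, neg_neg, Rm]
  refine Finset.sum_congr rfl fun a _ => ?_
  simp only [h1, raise₂, Finset.mul_sum, Finset.sum_mul]
  rw [Finset.sum_comm]
  refine Finset.sum_congr rfl fun b _ => ?_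
  rw [Finset.sum_comm]
  exact Finset.sum_congr rfl fun m _ => Finset.sum_congr rfl fun l _ => by rw [S.gi_symm l m]; ring

/-- By pair symmetry of the Riemann tensor, transposing h amounts to exchanging i and k. -/
theorem curvature_term_transpose (h : Matrix (Fin n) (Fin n) A) (i k : Fin n) :
    ∑ j, ∑ l, S.Rm i j k l * S.raise₂ h.transpose j l
      = ∑ j, ∑ l, S.Rm k j i l * S.raise₂ h j l := by
  rw [Finset.sum_comm]
  refine Finset.sum_congr rfl fun j _ => Finset.sum_congr rfl fun l _ => ?_
  rw [S.Rm_pair]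
  congr 1
  simp only [raise₂, Matrix.transpose_apply]
  rw [Finset.sum_comm]
  exact Finset.sum_congr rfl fun a _ => Finset.sum_congr rfl fun b _ => by ring

theorem raise₂_add (h h' : Matrix (Fin n) (Fin n) A) (j l : Fin n) :
    S.raise₂ (h + h') j l = S.raise₂ h j l + S.raise₂ h' j l := by
  simp only [raise₂, Matrix.add_apply, mul_add, Finset.sum_add_distrib]

omit [Algebra ℝ A] in
theorem sum_comm₄ (t : Fin n → Fin n → Fin n → Fin n → A) :
    ∑ a, ∑ b, ∑ c, ∑ d, t a b c d = ∑ c, ∑ d, ∑ a, ∑ b, t a b c d := by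
  calc ∑ a, ∑ b, ∑ c, ∑ d, t a b c d
      = ∑ a, ∑ c, ∑ b, ∑ d, t a b c d := Finset.sum_congr rfl fun _ _ => Finset.sum_comm
    _ = ∑ c, ∑ a, ∑ b, ∑ d, t a b c d := Finset.sum_comm
    _ = ∑ c, ∑ a, ∑ d, ∑ b, t a b c d := Finset.sum_congr rfl fun _ _ =>
        Finset.sum_congr rfl fun _ _ => Finset.sum_comm
    _ = ∑ c, ∑ d, ∑ a, ∑ b, t a b c d := Finset.sum_congr rfl fun _ _ => Finset.sum_comm

/-! ### Consequences of Ric = Dξ, with ξ dual to X -/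

section Soliton

variable {S} {X : Fin n → A} (hX : ∀ i j, S.Ric i j = S.D1 (S.lower X) i j)
include hX

theorem DV_soliton (i j : Fin n) : S.DV X i j = S.RicMixed i j := by
  simp only [RicMixed, hX, D1_lower]
  exact (S.raise_lower (fun q => S.DV X i q) j).symm

/-- As Ric = Dξ, the left side is a commutator of second derivatives of ξ, which the Ricci identity
evaluates. -/
theorem D2_Ric_sub (i p k : Fin n) :
    S.D2 S.Ric p i k - S.D2 S.Ric k i p = -∑ j, X j * S.Rm j i p k := by
  rw [S.D2_symm S.Ric_symm p, S.D2_symm S.Ric_symm k]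
  have h : S.Ric = S.D1 (S.lower X) := by funext i j; exact hX i j
  rw [h, S.ricci_identity₁, sub_sub_cancel_left]
  congr 1
  simp only [lower, Finset.mul_sum]
  rw [Finset.sum_comm]
  refine Finset.sum_congr rfl fun j _ => ?_
  rw [S.Rm_pair, Rm, Finset.mul_sum]
  exact Finset.sum_congr rfl fun m _ => by rw [S.g_symm]; ring

/-- Contracted Bianchi plus `D2_Ric_sub`. Those concern the tensor with all indices down, so the
identity is proved after lowering m and then raised back. -/
theorem div_DF_soliton (i m k : Fin n) :
    ∑ a, ∑ b, S.gi a b * S.DF a b i m k = -∑ j, X j * S.F j i m k := by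
  have h : ∀ p, ∑ m, S.g p m * ∑ a, ∑ b, S.gi a b * S.DF a b i m k
      = ∑ m, S.g p m * -∑ j, X j * S.F j i m k := fun p => by
    have h1 : ∑ m, S.g p m * ∑ a, ∑ b, S.gi a b * S.DF a b i m k
        = ∑ a, ∑ b, S.gi a b * S.D4 S.Rm a b i p k := by
      simp only [D4_Rm, Finset.mul_sum]
      rw [Finset.sum_comm]
      refine Finset.sum_congr rfl fun a _ => ?_
      rw [Finset.sum_comm]
      exact Finset.sum_congr rfl fun b _ => Finset.sum_congr rfl fun m _ => by ring
    rw [h1, S.div_Rm, D2_Ric_sub hX]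
    simp only [Rm, Finset.mul_sum, mul_neg, Finset.sum_neg_distrib]
    rw [Finset.sum_comm]
    exact congrArg _ (Finset.sum_congr rfl fun b _ => Finset.sum_congr rfl fun m _ => by ring)
  rw [← S.raise_lower (fun m => ∑ a, ∑ b, S.gi a b * S.DF a b i m k) m]
  simp only [h]
  exact S.raise_lower (fun m => -∑ j, X j * S.F j i m k) m

/-- The dual of the gradient of a steady soliton satisfies `Δξ + D_X ξ = 0`. -/
theorem lap1_soliton (k : Fin n) :
    S.lap1 (S.lower X) k = -∑ j, X j * S.D1 (S.lower X) j k := by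
  have h : S.D1 (S.lower X) = S.Ric := by funext i j; exact (hX i j).symm
  rw [lap1, h]
  -- Ric is expanded as a trace of the Riemann tensor, so that the remaining contraction over a and
  -- b is the divergence computed by `div_Rm`.
  have h1 : ∀ a b, S.D2 S.Ric a b k = -∑ c, ∑ d, S.gi c d * S.D4 S.Rm a b c d k := fun a b => by
    rw [S.D2_symm S.Ric_symm, ← S.trace_DF a b k, ← Finset.sum_neg_distrib]
    refine Finset.sum_congr rfl fun c _ => ?_
    rw [← S.raise_lower (fun m => S.DF a c b m k) c, ← Finset.sum_neg_distrib]
    refine Finset.sum_congr rfl fun d _ => ?_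
    rw [D4_Rm_antisymm_left, mul_neg, neg_neg, D4_Rm]
  have h2 : ∑ a, ∑ b, S.gi a b * S.D2 S.Ric a b k
      = -∑ c, ∑ d, S.gi c d * ∑ a, ∑ b, S.gi a b * S.D4 S.Rm a b c d k := by
    simp only [h1, mul_neg, Finset.sum_neg_distrib, Finset.mul_sum]
    congr 1
    rw [sum_comm₄]
    exact Finset.sum_congr rfl fun c _ => Finset.sum_congr rfl fun d _ =>
      Finset.sum_congr rfl fun a _ => Finset.sum_congr rfl fun b _ => by ring
  rw [h2]
  simp only [S.div_Rm, D2_Ric_sub hX]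
  congr 1
  simp only [Ric, Finset.mul_sum, ← Finset.sum_neg_distrib]
  conv_rhs => rw [Finset.sum_comm]
  refine Finset.sum_congr rfl fun c _ => ?_
  conv_rhs => rw [Finset.sum_comm]
  refine Finset.sum_congr rfl fun d _ => Finset.sum_congr rfl fun j _ => ?_
  rw [S.Rm_antisymm_right]
  ring

/-- If the `1`-form `w` solves `Δw + D_X w = 0` on a steady soliton, then the symmetrized covariant
derivative `h` of `w` solves `Δ_L h + L_X h = 0`. -/
theorem Lich_add_Lie_soliton {w : Fin n → A}
    (hw : ∀ k, S.lap1 w k = -∑ j, X j * S.D1 w j k) (i k : Fin n) :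
    S.Lich (S.D1 w + (S.D1 w).transpose) i k
      + S.Lie X (S.D1 w + (S.D1 w).transpose) i k = 0 := by
  obtain ⟨B, hB⟩ : ∃ B, S.D1 w = B := ⟨_, rfl⟩
  rw [hB]
  -- The equation already holds for B before symmetrization. The Ricci term of `lap2_D1` cancels
  -- against D_i X, and the curvature term from commuting D_i and D_j cancels against the divergence
  -- of the curvature.
  have key : ∀ i k, S.lap2 B i k + ∑ j, X j * S.D2 B j i k
      + 2 * ∑ j, ∑ l, S.Rm i j k l * S.raise₂ B j l = 0 := fun i k => by
    have hw' : S.lap1 w = fun k => ∑ j, (-X j) * S.D1 w j k := by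
      funext k; rw [hw]; simp only [neg_mul, Finset.sum_neg_distrib]
    have h1 : ∀ j, S.DV (fun j => -X j) i j = -S.RicMixed i j := fun j => by
      rw [← DV_soliton hX]
      simp only [DV, map_neg, mul_neg, Finset.sum_neg_distrib]
      ring
    have h2 : ∀ j, S.D2 (S.D1 w) j i k = S.D2 (S.D1 w) i j k - ∑ m, S.F j i m k * w m :=
      fun j => S.ricci_identity₁ w j i k
    have h3 : ∑ j, X j * ∑ m, S.F j i m k * w m = ∑ m, (∑ j, X j * S.F j i m k) * w m := by
      simp only [Finset.mul_sum, Finset.sum_mul, mul_assoc]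
      exact Finset.sum_comm
    rw [← hB, curvature_term, lap2_D1, hw', S.D1_dir]
    simp only [h1, div_DF_soliton hX, h2, mul_sub, neg_mul, Finset.sum_neg_distrib,
      Finset.sum_sub_distrib, h3]
    ring
  have e1 : S.lap2 (B + B.transpose) i k = S.lap2 B i k + S.lap2 B k i := by
    simp only [lap2, D3_D2_add, D3_D2_transpose, mul_add, Finset.sum_add_distrib]
  have e2 : ∑ j, ∑ l, S.Rm i j k l * S.raise₂ (B + B.transpose) j l
      = ∑ j, ∑ l, S.Rm i j k l * S.raise₂ B j l + ∑ j, ∑ l, S.Rm k j i l * S.raise₂ B j l := by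
    rw [← S.curvature_term_transpose B i k]
    simp only [raise₂_add, mul_add, Finset.sum_add_distrib]
  -- With DX = Ric, the zeroth-order terms of the Lie derivative cancel the Ricci terms of `Lich`;
  -- the rest is `key` plus its transpose.
  rw [Lich, Lie_eq, e1, e2]
  simp only [DV_soliton hX, D2_add, D2_transpose, mul_add, Finset.sum_add_distrib,
    Matrix.add_apply, Matrix.transpose_apply]
  linear_combination key i k + key k i

end Soliton

end MetricCalculus

section Coordinates

variable {n : ℕ} {U : TopologicalSpace.Opens (Coord n)}

/-! ### Smooth functions on an open subset of the coordinate space -/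

theorem pd_congr {u v : Coord n → ℝ} (h : ∀ z ∈ U, u z = v z) (k : Fin n) {y : Coord n}
    (hy : y ∈ U) : pd k u y = pd k v y := by
  have : u =ᶠ[nhds y] v := Filter.eventuallyEq_of_mem (U.isOpen.mem_nhds hy) h
  rw [pd, pd, this.fderiv_eq]

theorem contDiffOn_pd {u : Coord n → ℝ} (hu : ContDiffOn ℝ ∞ u U) (k : Fin n) :
    ContDiffOn ℝ ∞ (pd k u) U :=
  (hu.fderiv_of_isOpen U.isOpen (m := ∞) (by simp)).clm_apply contDiffOn_const

theorem pd_comm {u : Coord n → ℝ} (hu : ContDiffOn ℝ ∞ u U) (i j : Fin n) {y : Coord n}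
    (hy : y ∈ U) : pd i (pd j u) y = pd j (pd i u) y := by
  have hat : ContDiffAt ℝ ∞ u y := hu.contDiffAt (U.isOpen.mem_nhds hy)
  have hd : DifferentiableAt ℝ (fderiv ℝ u) y :=
    ((hu.fderiv_of_isOpen U.isOpen (m := ∞) (by simp)).contDiffAt
      (U.isOpen.mem_nhds hy)).differentiableAt (by simp)
  have h : ∀ i j, pd i (pd j u) y
      = fderiv ℝ (fderiv ℝ u) y (EuclideanSpace.single i 1) (EuclideanSpace.single j 1) := by
    intro i j
    change fderiv ℝ (fun z => fderiv ℝ u z (EuclideanSpace.single j 1)) y _ = _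
    rw [fderiv_clm_apply hd (differentiableAt_const _)]
    simp
  rw [h, h]
  exact (hat.isSymmSndFDerivAt (by simpa using ENat.LEInfty.out)).eq _ _

/-- The algebra of smooth functions on the open set `U`. -/
def smoothSubalgebra (U : TopologicalSpace.Opens (Coord n)) : Subalgebra ℝ (U → ℝ) where
  carrier := {a | ∃ v : Coord n → ℝ, ContDiffOn ℝ ∞ v U ∧ ∀ p : U, v p = a p}
  mul_mem' := by
    rintro a b ⟨v, hv, hva⟩ ⟨w, hw, hwb⟩
    exact ⟨fun z => v z * w z, hv.mul hw, fun p => by simp [hva, hwb]⟩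
  add_mem' := by
    rintro a b ⟨v, hv, hva⟩ ⟨w, hw, hwb⟩
    exact ⟨fun z => v z + w z, hv.add hw, fun p => by simp [hva, hwb]⟩
  algebraMap_mem' c := ⟨fun _ => c, contDiffOn_const, fun _ => rfl⟩

/-- The ring of smooth functions on the open set `U`. -/
abbrev SmoothFun (U : TopologicalSpace.Opens (Coord n)) : Type := smoothSubalgebra U

/-- Evaluation at a point. -/
def ev (p : U) : SmoothFun U →ₐ[ℝ] ℝ :=
  (Pi.evalAlgHom ℝ (fun _ : U => ℝ) p).comp (smoothSubalgebra U).val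

theorem SmoothFun.ext {a b : SmoothFun U} (h : ∀ p, ev p a = ev p b) : a = b :=
  Subtype.ext (funext h)

/-- The function `v` restricts to `a` on `U`. -/
def Represents (v : Coord n → ℝ) (a : SmoothFun U) : Prop := ∀ p : U, v p = ev p a

/-- The element of `SmoothFun U` given by a function that is smooth on `U`. -/
def SmoothFun.mk (v : Coord n → ℝ) (hv : ContDiffOn ℝ ∞ v U) : SmoothFun U :=
  ⟨fun p => v p, v, hv, fun _ => rfl⟩

theorem represents_mk (v : Coord n → ℝ) (hv : ContDiffOn ℝ ∞ v U) :
    Represents v (SmoothFun.mk v hv) := fun _ => rfl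

/-- An extension of a smooth function on `U` to the whole space. -/
def SmoothFun.extend (a : SmoothFun U) : Coord n → ℝ := a.2.choose

theorem SmoothFun.contDiffOn_extend (a : SmoothFun U) : ContDiffOn ℝ ∞ a.extend U :=
  a.2.choose_spec.1

theorem SmoothFun.represents_extend (a : SmoothFun U) : Represents a.extend a :=
  a.2.choose_spec.2

theorem SmoothFun.differentiableAt_extend (a : SmoothFun U) (p : U) :
    DifferentiableAt ℝ a.extend p :=
  (a.contDiffOn_extend.contDiffAt (U.isOpen.mem_nhds p.2)).differentiableAt (by simp)

/-- The partial derivative of a smooth function on `U`. -/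
def SmoothFun.deriv (k : Fin n) (a : SmoothFun U) : SmoothFun U :=
  SmoothFun.mk (pd k a.extend) (contDiffOn_pd a.contDiffOn_extend k)

/-- Since U is open, derivatives on U depend only on values on U; hence the choice made in `extend`
is immaterial. -/
theorem Represents.pd_deriv {v : Coord n → ℝ} {a : SmoothFun U} (h : Represents v a) (k : Fin n) :
    Represents (pd k v) (a.deriv k) := fun p =>
  pd_congr (fun z hz => (h ⟨z, hz⟩).trans (a.represents_extend ⟨z, hz⟩).symm) k p.2

/-- Partial differentiation as a derivation. -/
def partialDerivation (k : Fin n) : Derivation ℝ (SmoothFun U) (SmoothFun U) :=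
  Derivation.mk'
    { toFun := SmoothFun.deriv k
      map_add' := fun a b => SmoothFun.ext fun p => by
        have h : Represents (fun z => a.extend z + b.extend z) (a + b) := fun p => by
          simp only [map_add, a.represents_extend p, b.represents_extend p]
        rw [← h.pd_deriv k p, map_add, ← a.represents_extend.pd_deriv k p,
          ← b.represents_extend.pd_deriv k p, pd,
          fderiv_fun_add (a.differentiableAt_extend p) (b.differentiableAt_extend p)]
        rfl
      map_smul' := fun c a => SmoothFun.ext fun p => by
        have h : Represents (fun z => c * a.extend z) (c • a) := fun p => by
          simp only [map_smul, a.represents_extend p, smul_eq_mul]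
        rw [← h.pd_deriv k p, RingHom.id_apply, map_smul, ← a.represents_extend.pd_deriv k p, pd,
          fderiv_const_mul (a.differentiableAt_extend p)]
        rfl }
    fun a b => SmoothFun.ext fun p => by
      have h : Represents (fun z => a.extend z * b.extend z) (a * b) := fun p => by
        simp only [map_mul, a.represents_extend p, b.represents_extend p]
      change ev p ((a * b).deriv k) = ev p (a • b.deriv k + b • a.deriv k)
      rw [← h.pd_deriv k p, smul_eq_mul, smul_eq_mul, map_add, map_mul, map_mul,
        ← a.represents_extend.pd_deriv k p, ← b.represents_extend.pd_deriv k p,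
        ← a.represents_extend p, ← b.represents_extend p, pd,
        fderiv_fun_mul (a.differentiableAt_extend p) (b.differentiableAt_extend p)]
      rfl

theorem Represents.pd {v : Coord n → ℝ} {a : SmoothFun U} (h : Represents v a) (k : Fin n) :
    Represents (pd k v) (partialDerivation k a) := h.pd_deriv k

theorem partialDerivation_comm (i j : Fin n) (a : SmoothFun U) :
    partialDerivation i (partialDerivation j a) = partialDerivation j (partialDerivation i a) :=
  SmoothFun.ext fun p => by
    rw [← (a.represents_extend.pd j).pd i p, ← (a.represents_extend.pd i).pd j p,
      pd_comm a.contDiffOn_extend i j p.2]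

/-! ### Tensor calculus over the algebra of smooth functions -/

/-- A smooth family of matrices that is symmetric and invertible on `U`. -/
structure IsMetricOn (G : Coord n → Matrix (Fin n) (Fin n) ℝ)
    (U : TopologicalSpace.Opens (Coord n)) : Prop where
  contDiffOn : ∀ i j, ContDiffOn ℝ ∞ (fun y => G y i j) U
  symm : ∀ y ∈ U, ∀ i j, G y i j = G y j i
  isUnit_det : ∀ y ∈ U, IsUnit (G y).det

variable {G : Coord n → Matrix (Fin n) (Fin n) ℝ}

theorem IsMetricOn.contDiffOn_det (hG : IsMetricOn G U) : ContDiffOn ℝ ∞ (fun y => (G y).det) U := by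
  simp only [Matrix.det_apply']
  exact ContDiffOn.sum fun σ _ => contDiffOn_const.mul (contDiffOn_prod fun i _ => hG.contDiffOn _ _)

/-- Cramer's rule: an entry of the inverse is a determinant, polynomial in the entries of G and
constants, divided by the nonvanishing det G. -/
theorem IsMetricOn.contDiffOn_invMetric (hG : IsMetricOn G U) (i j : Fin n) :
    ContDiffOn ℝ ∞ (fun y => invMetric G y i j) U := by
  have h : ContDiffOn ℝ ∞ (fun y => ((G y).det)⁻¹ * ((G y).updateRow j (Pi.single i 1)).det) U := by
    refine (hG.contDiffOn_det.inv fun y hy => (hG.isUnit_det y hy).ne_zero).mul ?_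
    simp only [Matrix.det_apply']
    refine ContDiffOn.sum fun σ _ => contDiffOn_const.mul (contDiffOn_prod fun l _ => ?_)
    by_cases h : σ l = j
    · simp only [h, Matrix.updateRow_self]
      exact contDiffOn_const
    · simp only [Matrix.updateRow_ne h]
      exact hG.contDiffOn _ _
  refine h.congr fun y _ => ?_
  rw [invMetric, Matrix.inv_def, Matrix.smul_apply, Ring.inverse_eq_inv', smul_eq_mul,
    Matrix.adjugate_apply]

/-- The metric calculus of a metric on `U`. -/
def IsMetricOn.calculus (hG : IsMetricOn G U) : MetricCalculus n (SmoothFun U) where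
  d := partialDerivation
  d_comm := partialDerivation_comm
  g i j := SmoothFun.mk (fun y => G y i j) (hG.contDiffOn i j)
  gi i j := SmoothFun.mk (fun y => invMetric G y i j) (hG.contDiffOn_invMetric i j)
  g_symm i j := SmoothFun.ext fun p => hG.symm p p.2 i j
  gi_symm i j := SmoothFun.ext fun p => by
    have h : (G p).transpose = G p := by ext i j; exact hG.symm p p.2 j i
    have h' : (G p)⁻¹.transpose = (G p)⁻¹ := by rw [Matrix.transpose_nonsing_inv, h]
    exact congrFun (congrFun h' j) i
  g_mul_gi := by
    refine Matrix.ext fun i j => SmoothFun.ext fun p => ?_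
    change ev p (∑ l, SmoothFun.mk (fun y => G y i l) (hG.contDiffOn i l)
      * SmoothFun.mk (fun y => invMetric G y l j) (hG.contDiffOn_invMetric l j)) = _
    simp only [map_sum, map_mul, Matrix.one_apply, apply_ite (ev p), map_one, map_zero]
    have h := congrFun (congrFun (Matrix.mul_nonsing_inv (G p) (hG.isUnit_det p p.2)) i) j
    rwa [Matrix.mul_apply, Matrix.one_apply] at h

/-! ### Coordinate expressions as elements of the algebra of smooth functions -/

section Transport

variable (hG : IsMetricOn G U)

theorem rep_g (i j : Fin n) : Represents (fun y => G y i j) (hG.calculus.g i j) := fun _ => rfl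

theorem rep_gi (i j : Fin n) : Represents (fun y => invMetric G y i j) (hG.calculus.gi i j) :=
  fun _ => rfl

theorem rep_d {v : Coord n → ℝ} {a : SmoothFun U} (h : Represents v a) (k : Fin n) :
    Represents (pd k v) (hG.calculus.d k a) := h.pd k

/-- Evaluation at a point is an algebra homomorphism and `rep_d` matches derivations with partial
derivatives, so the coordinate formula and the abstract one agree term by term. The later `rep_`
lemmas work the same way. -/
theorem rep_Γ (k i j : Fin n) :
    Represents (fun y => christoffel G y k i j) (hG.calculus.Γ k i j) := fun p => by
  simp only [christoffel, MetricCalculus.Γ, map_smul, map_sum, map_mul, map_add, map_sub,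
    smul_eq_mul, (rep_gi hG _ _) p, (rep_d hG (rep_g hG _ _) _) p]

theorem rep_F (i j l m : Fin n) :
    Represents (fun y => curvatureOp G y i j l m) (hG.calculus.F i j m l) := fun p => by
  simp only [curvatureOp, MetricCalculus.F_apply, map_sum, map_mul, map_add, map_sub,
    (rep_Γ hG _ _ _) p, (rep_d hG (rep_Γ hG _ _ _) _) p]

theorem rep_Rm (i j k l : Fin n) :
    Represents (fun y => riemann G y i j k l) (hG.calculus.Rm i j k l) := fun p => by
  simp only [riemann, MetricCalculus.Rm, map_sum, map_mul, (rep_g hG _ _) p, (rep_F hG _ _ _ _) p]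

theorem rep_Ric (i k : Fin n) :
    Represents (fun y => ricci G y i k) (hG.calculus.Ric i k) := fun p => by
  simp only [ricci, MetricCalculus.Ric, map_sum, map_mul, (rep_gi hG _ _) p,
    (rep_Rm hG _ _ _ _) p]

theorem rep_RicMixed (i l : Fin n) :
    Represents (fun y => ricciMixed G y i l) (hG.calculus.RicMixed i l) := fun p => by
  simp only [ricciMixed, MetricCalculus.RicMixed, map_sum, map_mul, (rep_gi hG _ _) p,
    (rep_Ric hG _ _) p]

theorem rep_hessian {u : Coord n → ℝ} {a : SmoothFun U} (h : Represents u a) (i j : Fin n) :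
    Represents (fun y => hessian G u y i j)
      (hG.calculus.D1 (fun k => hG.calculus.d k a) i j) := fun p => by
  simp only [hessian, MetricCalculus.D1, map_sum, map_mul, map_sub, (rep_Γ hG _ _ _) p,
    (rep_d hG h _) p, (rep_d hG (rep_d hG h _) _) p]

section Vector

variable {V : Coord n → Fin n → ℝ} {v : Fin n → SmoothFun U}
  (hV : ∀ i, Represents (fun y => V y i) (v i))
include hV

theorem rep_DV (j i : Fin n) :
    Represents (fun y => covVec G V y j i) (hG.calculus.DV v j i) := fun p => by
  simp only [covVec, MetricCalculus.DV, map_sum, map_mul, map_add, (rep_Γ hG _ _ _) p,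
    (rep_d hG (hV _) _) p, hV _ p]

theorem rep_DVV (j k i : Fin n) :
    Represents (fun y => covVec₂ G V y j k i) (hG.calculus.DVV v j k i) := fun p => by
  simp only [covVec₂, MetricCalculus.DVV, map_sum, map_mul, map_add, map_sub, (rep_Γ hG _ _ _) p,
    (rep_d hG (rep_DV hG hV _ _) _) p, rep_DV hG hV _ _ p]

theorem rep_lapVec (i : Fin n) : Represents (fun y => lapVec G V y i)
    (∑ j, ∑ k, hG.calculus.gi j k * hG.calculus.DVV v j k i) := fun p => by
  simp only [lapVec, map_sum, map_mul, (rep_gi hG _ _) p, rep_DVV hG hV _ _ _ p]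

theorem rep_Lie {h : Coord n → Matrix (Fin n) (Fin n) ℝ} {t : Matrix (Fin n) (Fin n) (SmoothFun U)}
    (ht : ∀ i j, Represents (fun y => h y i j) (t i j)) (i j : Fin n) :
    Represents (fun y => lieDeriv V h y i j) (hG.calculus.Lie v t i j) := fun p => by
  simp only [lieDeriv, MetricCalculus.Lie, map_sum, map_mul, map_add, hV _ p, ht _ _ p,
    (rep_d hG (hV _) _) p, (rep_d hG (ht _ _) _) p]

theorem rep_dirCovVec {X : Coord n → Fin n → ℝ} {x : Fin n → SmoothFun U}
    (hX : ∀ i, Represents (fun y => X y i) (x i)) (i : Fin n) :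
    Represents (fun y => dirCovVec G X V y i) (∑ j, x j * hG.calculus.DV v j i) := fun p => by
  simp only [dirCovVec, map_sum, map_mul, hX _ p, rep_DV hG hV _ _ p]

end Vector

section Tensor

variable {h : Coord n → Matrix (Fin n) (Fin n) ℝ} {t : Matrix (Fin n) (Fin n) (SmoothFun U)}
  (ht : ∀ i j, Represents (fun y => h y i j) (t i j))
include ht

theorem rep_D2 (k i j : Fin n) :
    Represents (fun y => covTen G h y k i j) (hG.calculus.D2 t k i j) := fun p => by
  simp only [covTen, MetricCalculus.D2, map_sum, map_mul, map_add, map_sub, (rep_Γ hG _ _ _) p,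
    (rep_d hG (ht _ _) _) p, ht _ _ p]

theorem rep_D3 (l k i j : Fin n) :
    Represents (fun y => covTen₂ G h y l k i j)
      (hG.calculus.D3 (hG.calculus.D2 t) l k i j) := fun p => by
  simp only [covTen₂, MetricCalculus.D3, map_sum, map_mul, map_add, map_sub, (rep_Γ hG _ _ _) p,
    (rep_d hG (rep_D2 hG ht _ _ _) _) p, rep_D2 hG ht _ _ _ p]

theorem rep_Lich (i k : Fin n) :
    Represents (fun y => lichnerowicz G h y i k) (hG.calculus.Lich t i k) := fun p => by
  simp only [lichnerowicz, lapTen, raiseBoth, MetricCalculus.Lich, MetricCalculus.lap2,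
    MetricCalculus.raise₂, map_sum, map_mul, map_add, map_sub, map_ofNat, rep_gi hG _ _ p,
    rep_D3 hG ht _ _ _ _ p, rep_Rm hG _ _ _ _ p, rep_RicMixed hG _ _ p, ht _ _ p]

end Tensor

end Transport

/-! ### Steady solitons in coordinates -/

theorem exists_represents {V : Coord n → Fin n → ℝ}
    (hV : ∀ i, ContDiffOn ℝ ∞ (fun y => V y i) U) :
    ∃ v : Fin n → SmoothFun U, ∀ i, Represents (fun y => V y i) (v i) :=
  ⟨fun i => SmoothFun.mk _ (hV i), fun i => represents_mk _ (hV i)⟩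

variable {u : Coord n → ℝ} {X : Coord n → Fin n → ℝ}

theorem lower_gradient (hG : IsMetricOn G U) {a : SmoothFun U} {x : Fin n → SmoothFun U}
    (ha : Represents u a) (hx : ∀ i, Represents (fun y => X y i) (x i))
    (hX : ∀ y ∈ U, ∀ j, ∑ i, G y j i * X y i = pd j u y) :
    hG.calculus.lower x = fun k => hG.calculus.d k a := by
  funext k
  refine SmoothFun.ext fun p => ?_
  rw [← rep_d hG ha k p, ← hX p p.2]
  simp only [MetricCalculus.lower, map_sum, map_mul, ← hx _ p, ← rep_g hG _ _ p]

theorem Ric_eq_D1_lower (hG : IsMetricOn G U) {a : SmoothFun U} {x : Fin n → SmoothFun U}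
    (ha : Represents u a) (hx : ∀ i, Represents (fun y => X y i) (x i))
    (hX : ∀ y ∈ U, ∀ j, ∑ i, G y j i * X y i = pd j u y)
    (hsol : ∀ y ∈ U, ∀ i j, ricci G y i j = hessian G u y i j) (i j : Fin n) :
    hG.calculus.Ric i j = hG.calculus.D1 (hG.calculus.lower x) i j := by
  rw [lower_gradient hG ha hx hX]
  exact SmoothFun.ext fun p =>
    (rep_Ric hG i j p).symm.trans ((hsol p p.2 i j).trans (rep_hessian hG ha i j p))

/-- The passage from the equation for vector fields to the one for dual 1-forms, in which the
abstract results are phrased. -/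
theorem lower_lapVec_add (hG : IsMetricOn G U) (x v : Fin n → SmoothFun U) (k : Fin n) :
    ∑ i, hG.calculus.g k i * (∑ a, ∑ b, hG.calculus.gi a b * hG.calculus.DVV v a b i
        + ∑ j, x j * hG.calculus.DV v j i)
      = hG.calculus.lap1 (hG.calculus.lower v) k
        + ∑ j, x j * hG.calculus.D1 (hG.calculus.lower v) j k := by
  simp only [mul_add, Finset.sum_add_distrib, MetricCalculus.lap1_lower, MetricCalculus.D1_lower]
  congr 1
  simp only [Finset.mul_sum]
  rw [Finset.sum_comm]
  exact Finset.sum_congr rfl fun _ _ => Finset.sum_congr rfl fun _ _ => by ring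

theorem lichnerowicz_lieDeriv_of_soliton (hG : IsMetricOn G U) (hu : ContDiffOn ℝ ∞ u U)
    (hXs : ∀ i, ContDiffOn ℝ ∞ (fun y => X y i) U)
    (hX : ∀ y ∈ U, ∀ j, ∑ i, G y j i * X y i = pd j u y)
    (hsol : ∀ y ∈ U, ∀ i j, ricci G y i j = hessian G u y i j)
    {V : Coord n → Fin n → ℝ} (hV : ∀ i, ContDiffOn ℝ ∞ (fun y => V y i) U)
    (hVeq : ∀ y ∈ U, ∀ i, lapVec G V y i + dirCovVec G X V y i = 0)
    {y : Coord n} (hy : y ∈ U) (i k : Fin n) :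
    lichnerowicz G (lieDeriv V G) y i k + lieDeriv X (lieDeriv V G) y i k = 0 := by
  obtain ⟨x, hx⟩ := exists_represents hXs
  obtain ⟨v, hv⟩ := exists_represents hV
  have hR := Ric_eq_D1_lower hG (represents_mk u hu) hx hX hsol
  have hw : ∀ k, hG.calculus.lap1 (hG.calculus.lower v) k
      = -∑ j, x j * hG.calculus.D1 (hG.calculus.lower v) j k := fun k => by
    rw [eq_neg_iff_add_eq_zero, ← lower_lapVec_add]
    refine Finset.sum_eq_zero fun i _ => ?_
    have : ∑ a, ∑ b, hG.calculus.gi a b * hG.calculus.DVV v a b i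
        + ∑ j, x j * hG.calculus.DV v j i = 0 := SmoothFun.ext fun p => by
      rw [map_add, ← rep_lapVec hG hv i p, ← rep_dirCovVec hG hv hx i p, hVeq p p.2, map_zero]
    rw [this, mul_zero]
  have hL := rep_Lie hG hv (rep_g hG)
  have key := congrArg (ev ⟨y, hy⟩) (MetricCalculus.Lich_add_Lie_soliton hR hw i k)
  rw [← MetricCalculus.Lie_g, map_add, ← rep_Lich hG hL i k ⟨y, hy⟩,
    ← rep_Lie hG hx hL i k ⟨y, hy⟩, map_zero] at key
  exact key

theorem lapVec_gradient_of_soliton (hG : IsMetricOn G U) (hu : ContDiffOn ℝ ∞ u U)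
    (hXs : ∀ i, ContDiffOn ℝ ∞ (fun y => X y i) U)
    (hX : ∀ y ∈ U, ∀ j, ∑ i, G y j i * X y i = pd j u y)
    (hsol : ∀ y ∈ U, ∀ i j, ricci G y i j = hessian G u y i j)
    {y : Coord n} (hy : y ∈ U) (i : Fin n) :
    lapVec G X y i + dirCovVec G X X y i = 0 := by
  obtain ⟨x, hx⟩ := exists_represents hXs
  have hR := Ric_eq_D1_lower hG (represents_mk u hu) hx hX hsol
  have h0 : ∀ k, ∑ i, hG.calculus.g k i * (∑ a, ∑ b, hG.calculus.gi a b * hG.calculus.DVV x a b i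
        + ∑ j, x j * hG.calculus.DV x j i) = 0 := fun k => by
    rw [lower_lapVec_add, MetricCalculus.lap1_soliton hR, neg_add_cancel]
  -- The lowered expression vanishes, and raising the index with the inverse metric recovers the
  -- vector equation.
  have h1 : ∑ a, ∑ b, hG.calculus.gi a b * hG.calculus.DVV x a b i
        + ∑ j, x j * hG.calculus.DV x j i = 0 := by
    rw [← hG.calculus.raise_lower (fun i => ∑ a, ∑ b, hG.calculus.gi a b * hG.calculus.DVV x a b i
        + ∑ j, x j * hG.calculus.DV x j i) i]
    simp only [h0, mul_zero, Finset.sum_const_zero]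
  have key := congrArg (ev ⟨y, hy⟩) h1
  rw [map_add, ← rep_lapVec hG hx i ⟨y, hy⟩, ← rep_dirCovVec hG hx hx i ⟨y, hy⟩, map_zero] at key
  exact key

theorem lichnerowicz_ricci_of_soliton (hG : IsMetricOn G U) (hu : ContDiffOn ℝ ∞ u U)
    (hXs : ∀ i, ContDiffOn ℝ ∞ (fun y => X y i) U)
    (hX : ∀ y ∈ U, ∀ j, ∑ i, G y j i * X y i = pd j u y)
    (hsol : ∀ y ∈ U, ∀ i j, ricci G y i j = hessian G u y i j)
    {y : Coord n} (hy : y ∈ U) (i k : Fin n) :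
    lichnerowicz G (ricci G) y i k + lieDeriv X (ricci G) y i k = 0 := by
  obtain ⟨x, hx⟩ := exists_represents hXs
  have hR := Ric_eq_D1_lower hG (represents_mk u hu) hx hX hsol
  set S := hG.calculus
  have hD : ∀ c : ℝ, S.D1 (c • S.lower x) = c • S.Ric := fun c => by
    refine Matrix.ext fun i j => ?_
    simp only [MetricCalculus.D1, Matrix.smul_apply, hR, Pi.smul_apply, Derivation.map_smul, mul_smul_comm,
      ← Finset.smul_sum, smul_sub]
  have hD2 : ∀ (c : ℝ) a b k, S.D2 (c • S.Ric) a b k = c • S.D2 S.Ric a b k := fun c a b k => by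
    simp only [MetricCalculus.D2, Matrix.smul_apply, Derivation.map_smul, mul_smul_comm, ← smul_add,
      ← Finset.smul_sum, smul_sub]
  -- The factor 1/2 compensates for symmetrization: Dξ + (Dξ)ᵀ = 2 Ric. The equation for ξ is
  -- linear, so it passes to ξ/2.
  have hw : ∀ k, S.lap1 ((1 / 2 : ℝ) • S.lower x) k
      = -∑ j, x j * S.D1 ((1 / 2 : ℝ) • S.lower x) j k := fun k => by
    have h := MetricCalculus.lap1_soliton hR k
    have hRic : S.D1 (S.lower x) = S.Ric := Matrix.ext fun i j => (hR i j).symm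
    simp only [MetricCalculus.lap1, hRic] at h
    simp only [MetricCalculus.lap1, hD, hD2, Matrix.smul_apply, mul_smul_comm, ← Finset.smul_sum, h,
      smul_neg]
  have hsum : S.D1 ((1 / 2 : ℝ) • S.lower x) + (S.D1 ((1 / 2 : ℝ) • S.lower x)).transpose
      = S.Ric := by
    refine Matrix.ext fun i j => ?_
    rw [hD, Matrix.add_apply, Matrix.transpose_apply, Matrix.smul_apply, Matrix.smul_apply,
      S.Ric_symm j i, ← add_smul]
    norm_num
  have key := congrArg (ev ⟨y, hy⟩) (MetricCalculus.Lich_add_Lie_soliton hR hw i k)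
  rw [hsum, map_add, ← rep_Lich hG (rep_Ric hG) i k ⟨y, hy⟩,
    ← rep_Lie hG hx (rep_Ric hG) i k ⟨y, hy⟩, map_zero] at key
  exact key

end Coordinates

section Manifold

variable {n : ℕ} {M : Type*} [TopologicalSpace M] [ChartedSpace (Coord n) M]
  [IsManifold (𝓡 n) ∞ M] {e : OpenPartialHomeomorph M (Coord n)}

/-! ### Metrics, vector fields and functions in charts -/

omit [IsManifold (𝓡 n) ∞ M] in
theorem mdifferentiable_of_mem_maximalAtlas (he : e ∈ IsManifold.maximalAtlas (𝓡 n) ∞ M) :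
    e.MDifferentiable (𝓡 n) (𝓡 n) :=
  ⟨(contMDiffOn_of_mem_maximalAtlas he).mdifferentiableOn (by simp),
    (contMDiffOn_symm_of_mem_maximalAtlas he).mdifferentiableOn (by simp)⟩

/-- The coordinate vector fields are smooth. -/
theorem contMDiffOn_mfderiv_symm (he : e ∈ IsManifold.maximalAtlas (𝓡 n) ∞ M) (v : Coord n) :
    ContMDiffOn (𝓡 n) ((𝓡 n).prod 𝓘(ℝ, Coord n)) ∞
      (fun y : Coord n => (Bundle.TotalSpace.mk' (Coord n) (e.symm y)
        (mfderiv (𝓡 n) (𝓡 n) e.symm y v) : TangentBundle (𝓡 n) M)) e.target := by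
  have : IsManifold (𝓡 n) 1 M := IsManifold.of_le (n := ∞) (by simp)
  have h1 := (contMDiffOn_symm_of_mem_maximalAtlas he).contMDiffOn_tangentMapWithin (m := ∞)
    (by simp) e.open_target.uniqueMDiffOn
  have h2 : ContMDiff (𝓡 n) ((𝓡 n).prod 𝓘(ℝ, Coord n)) ∞
      (fun y : Coord n => (Bundle.TotalSpace.mk' (Coord n) y v : TangentBundle (𝓡 n) (Coord n))) :=
    contMDiff_vectorSpace_iff_contDiff.2 contDiff_const
  refine (h1.comp h2.contMDiffOn fun y hy => hy).congr fun y hy => ?_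
  simp only [Function.comp, tangentMapWithin, mfderivWithin_of_isOpen e.open_target hy]

theorem contDiffOn_metricIn (g : Metric n M) (he : e ∈ IsManifold.maximalAtlas (𝓡 n) ∞ M)
    (i j : Fin n) : ContDiffOn ℝ ∞ (fun y => metricIn g e y i j) e.target := by
  have : IsManifold (𝓡 n) 1 M := IsManifold.of_le (n := ∞) (by simp)
  have hb := contMDiffOn_symm_of_mem_maximalAtlas he
  have h := ContMDiffOn.clm_bundle_apply₂ (F₁ := Coord n) (F₂ := Coord n) (F₃ := ℝ)
    (E₃ := Bundle.Trivial M ℝ) (b := e.symm) (ψ := fun y => g.inner (e.symm y))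
    (g.contMDiff.comp_contMDiffOn hb)
    (contMDiffOn_mfderiv_symm he (EuclideanSpace.single i 1))
    (contMDiffOn_mfderiv_symm he (EuclideanSpace.single j 1))
  rw [← contMDiffOn_iff_contDiffOn]
  intro y hy
  exact ((Bundle.contMDiffWithinAt_totalSpace).1 (h y hy)).2

/-- The components are the fibre part of the tangent map of e composed with the section W, read over
the inverse chart. -/
theorem contDiffOn_fieldIn {W : VField n M} (hW : W.IsSmooth)
    (he : e ∈ IsManifold.maximalAtlas (𝓡 n) ∞ M) (i : Fin n) :
    ContDiffOn ℝ ∞ (fun y => fieldIn W e y i) e.target := by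
  have : IsManifold (𝓡 n) 1 M := IsManifold.of_le (n := ∞) (by simp)
  have h1 := (contMDiffOn_of_mem_maximalAtlas he).contMDiffOn_tangentMapWithin (m := ∞)
    (by simp) e.open_source.uniqueMDiffOn
  have h2 := hW.comp_contMDiffOn (contMDiffOn_symm_of_mem_maximalAtlas he)
  have h3 := h1.comp h2 fun y hy => e.map_target hy
  have h4 := (contMDiff_snd_tangentBundle_modelSpace (Coord n) (𝓡 n) (n := ∞)).comp_contMDiffOn h3
  have h5 : ContDiffOn ℝ ∞ (fun y =>
      (mfderiv (𝓡 n) (𝓡 n) e (e.symm y) (W (e.symm y)) : Coord n)) e.target := by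
    refine (contMDiffOn_iff_contDiffOn.1 h4).congr fun y hy => ?_
    simp only [Function.comp, tangentMapWithin,
      mfderivWithin_of_isOpen e.open_source (e.map_target hy)]
    rfl
  exact (EuclideanSpace.proj (𝕜 := ℝ) i).contDiff.comp_contDiffOn h5

omit [IsManifold (𝓡 n) ∞ M] in
theorem contDiffOn_funIn {f : M → ℝ} (hf : ContMDiff (𝓡 n) 𝓘(ℝ, ℝ) ∞ f)
    (he : e ∈ IsManifold.maximalAtlas (𝓡 n) ∞ M) : ContDiffOn ℝ ∞ (funIn f e) e.target :=
  contMDiffOn_iff_contDiffOn.1 (hf.comp_contMDiffOn (contMDiffOn_symm_of_mem_maximalAtlas he))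

theorem sum_smul_single (w : Coord n) :
    ∑ i, w i • (EuclideanSpace.single i (1 : ℝ) : Coord n) = w := by
  ext j
  simp [Pi.single_apply]

/-- The metric in terms of its components. -/
theorem sum_metricIn_mul (g : Metric n M) (y : Coord n) (v : TangentSpace (𝓡 n) (e.symm y))
    (w : Coord n) :
    g.inner (e.symm y) v (mfderiv (𝓡 n) (𝓡 n) e.symm y w) = ∑ i, w i *
      g.inner (e.symm y) v (mfderiv (𝓡 n) (𝓡 n) e.symm y (EuclideanSpace.single i (1 : ℝ))) := by
  let L : Coord n →L[ℝ] ℝ := (g.inner (e.symm y) v).comp (mfderiv (𝓡 n) (𝓡 n) e.symm y)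
  have h : L w = ∑ i, w i * L (EuclideanSpace.single i (1 : ℝ)) := by
    conv_lhs => rw [← sum_smul_single w, map_sum]
    simp only [map_smul, smul_eq_mul]
  exact h

theorem metricIn_symm (g : Metric n M) (y : Coord n) (i j : Fin n) :
    metricIn g e y i j = metricIn g e y j i := g.symm _ _ _

/-- A kernel vector of the component matrix would give a tangent vector of zero length, nonzero
because the differential of the inverse chart is injective; this contradicts positivity. -/
theorem isUnit_det_metricIn (g : Metric n M) (he : e ∈ IsManifold.maximalAtlas (𝓡 n) ∞ M)
    {y : Coord n} (hy : y ∈ e.target) : IsUnit (metricIn g e y).det := by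
  rw [isUnit_iff_ne_zero]
  intro hdet
  obtain ⟨c, hc, h0⟩ := Matrix.exists_mulVec_eq_zero_iff.2 hdet
  let w : Coord n := WithLp.toLp 2 c
  have hw : w ≠ 0 := fun h => hc (by
    ext i; exact congrArg (fun z : Coord n => z i) h)
  have hinj : Function.Injective (mfderiv (𝓡 n) (𝓡 n) e.symm y) :=
    (mdifferentiable_of_mem_maximalAtlas he).symm.mfderiv_injective hy
  have hne : mfderiv (𝓡 n) (𝓡 n) e.symm y w ≠ 0 := fun h => hw (hinj (h.trans (map_zero _).symm))
  refine (g.pos _ _ hne).ne' ?_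
  rw [sum_metricIn_mul]
  refine Finset.sum_eq_zero fun i _ => ?_
  rw [g.symm, sum_metricIn_mul]
  exact mul_eq_zero_of_right _ ((Finset.sum_congr rfl fun j _ => mul_comm _ _).trans
    (congrFun h0 i))

theorem isMetricOn_metricIn (g : Metric n M) (he : e ∈ IsManifold.maximalAtlas (𝓡 n) ∞ M) :
    IsMetricOn (metricIn g e) ⟨e.target, e.open_target⟩ where
  contDiffOn := contDiffOn_metricIn g he
  symm y _ := metricIn_symm g y
  isUnit_det _ hy := isUnit_det_metricIn g he hy

/-- The components of the gradient. -/
theorem metricIn_gradient (g : Metric n M) {f : M → ℝ} (hf : ContMDiff (𝓡 n) 𝓘(ℝ, ℝ) ∞ f)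
    (he : e ∈ IsManifold.maximalAtlas (𝓡 n) ∞ M) {y : Coord n} (hy : y ∈ e.target) (j : Fin n) :
    ∑ i, metricIn g e y j i * fieldIn (gradient g f) e y i = pd j (funIn f e) y := by
  have hd := mdifferentiable_of_mem_maximalAtlas he
  -- The gradient is recovered from its components: the differentials of the chart and of its
  -- inverse cancel.
  have hinv : mfderiv (𝓡 n) (𝓡 n) e.symm y
      (mfderiv (𝓡 n) (𝓡 n) e (e.symm y) (gradient g f (e.symm y))) = gradient g f (e.symm y) := by
    have h := congrArg (fun L => L (gradient g f (e.symm y)))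
      (hd.symm_comp_deriv (e.map_target hy))
    rw [e.right_inv hy] at h
    exact h
  have h1 := sum_metricIn_mul g y
    (mfderiv (𝓡 n) (𝓡 n) e.symm y (EuclideanSpace.single j (1 : ℝ) : Coord n))
    (mfderiv (𝓡 n) (𝓡 n) e (e.symm y) (gradient g f (e.symm y)))
  rw [hinv, g.symm, inner_gradient] at h1
  have h2 : pd j (funIn f e) y = mfderiv (𝓡 n) 𝓘(ℝ, ℝ) f (e.symm y)
      (mfderiv (𝓡 n) (𝓡 n) e.symm y (EuclideanSpace.single j (1 : ℝ) : Coord n)) := by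
    have hc := mfderiv_comp y ((hf (e.symm y)).mdifferentiableAt (by simp))
      (hd.mdifferentiableAt_symm hy)
    rw [mfderiv_eq_fderiv] at hc
    exact congrArg (fun L => L (EuclideanSpace.single j (1 : ℝ))) hc
  rw [h2, h1]
  exact Finset.sum_congr rfl fun i _ => mul_comm _ _

/-- The gradient is defined pointwise by linear duality, so its smoothness is read off from the
formula X^i = g^{ij} ∂_j f. -/
theorem contDiffOn_fieldIn_gradient (g : Metric n M) {f : M → ℝ}
    (hf : ContMDiff (𝓡 n) 𝓘(ℝ, ℝ) ∞ f) (he : e ∈ IsManifold.maximalAtlas (𝓡 n) ∞ M) (i : Fin n) :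
    ContDiffOn ℝ ∞ (fun y => fieldIn (gradient g f) e y i) e.target := by
  have hG := isMetricOn_metricIn g he
  have h : ContDiffOn ℝ ∞ (fun y => ∑ j, invMetric (metricIn g e) y i j * pd j (funIn f e) y)
      e.target :=
    ContDiffOn.sum fun j _ => (hG.contDiffOn_invMetric i j).mul
      (contDiffOn_pd (U := ⟨e.target, e.open_target⟩) (contDiffOn_funIn hf he) j)
  refine h.congr fun y hy => ?_
  have hinv := Matrix.nonsing_inv_mul _ (hG.isUnit_det y hy)
  have h1 : (metricIn g e y).mulVec (fieldIn (gradient g f) e y)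
      = fun j => pd j (funIn f e) y := funext fun j => metricIn_gradient g hf he hy j
  have h2 := congrFun (congrArg ((metricIn g e y)⁻¹.mulVec) h1) i
  rw [Matrix.mulVec_mulVec, hinv, Matrix.one_mulVec] at h2
  exact h2

end Manifold

end RicciSoliton

end

/-! ### The theorem, chart by chart -/

open RicciSoliton in
theorem theorem3p1 {n : ℕ} {M : Type*} [TopologicalSpace M] [ChartedSpace (Coord n) M]
    [IsManifold (𝓡 n) ∞ M] (g : Metric n M) (f : M → ℝ) (hf : ContMDiff (𝓡 n) 𝓘(ℝ, ℝ) ∞ f)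
    (hsol : IsSteadyGradientSoliton g f) :
    (∀ W : VField n M, W.IsSmooth → SolvesVectorEq g (gradient g f) W →
      SolvesLichnerowiczEq g (gradient g f) (lieMetric g W)) ∧
    SolvesVectorEq g (gradient g f) (gradient g f) ∧
    SolvesLichnerowiczEq g (gradient g f) (ricciField g) := by
  refine ⟨fun W hW hWeq e he y hy i k => ?_, fun e he y hy i => ?_, fun e he y hy i k => ?_⟩
  · exact lichnerowicz_lieDeriv_of_soliton (isMetricOn_metricIn g he) (contDiffOn_funIn hf he)
      (contDiffOn_fieldIn_gradient g hf he) (fun y hy j => metricIn_gradient g hf he hy j)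
      (hsol e he) (contDiffOn_fieldIn hW he) (hWeq e he) hy i k
  · exact lapVec_gradient_of_soliton (isMetricOn_metricIn g he) (contDiffOn_funIn hf he)
      (contDiffOn_fieldIn_gradient g hf he) (fun y hy j => metricIn_gradient g hf he hy j)
      (hsol e he) hy i
  · exact lichnerowicz_ricci_of_soliton (isMetricOn_metricIn g he) (contDiffOn_funIn hf he)
      (contDiffOn_fieldIn_gradient g hf he) (fun y hy j => metricIn_gradient g hf he hy j)
      (hsol e he) hy i k
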